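/- Let $\rho:\mathfrak g\to\mathfrak{gl}(V)$ be a finite-dimensional complex representation of a finite-dimensional complex Lie algebra. For $x\in V$ let $R_x:\mathfrak g\to V$, $R_x(\xi)=\rho(\xi)x$, and let $r=\dim\mathcal O_{\mathrm{reg}}=\max_{x\in V}\operatorname{rk}R_x$ and $\operatorname{codim}\mathcal O_{\mathrm{reg}}=\dim V-r$. Let $\mathbb C[V]^{\mathfrak g}$ be the algebra of polynomial invariants, that is, of polynomials $f$ on $V$ with $R_x^*(df(x))=0$ for all $x\in V$. For $a\in V$ let $Y_a\subset\mathbb C[V]$ be the subalgebra generated by all polynomials $x\mapsto f(x+\lambda a)$ with $f\in\mathbb C[V]^{\mathfrak g}$ and $\lambda\in\mathbb C$. For a pencil $A+\lambda B$ of linear maps between finite-dimensional complex vector spaces, the total Kronecker $v$-index is the total number of rows in the vertical Kronecker blocks of its Kronecker canonical form. Here a vertical Kronecker block is a block of size $(\eta+1)\times\eta$, $\eta\ge 0$, whose $A$-part has ones at the positions $(i,i)$ and whose $B$-part has ones at the positions $(i+1,i)$, $1\le i\le\eta$, all other entries being zero; a zero block with $g$ rows and $h$ columns is counted as $g$ vertical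 blocks of size $1\times0$ and $h$ horizontal blocks of size $0\times 1$. Let $\mathsf k_{\mathrm{vert}}(\rho)$ be the total Kronecker $v$-index of the pencil $R_x+\lambda R_a$ for generic $(x,a)$, that is, its constant value on a suitable non-empty Zariski open subset of $V\times V$. Consider the $r\times r$ minors of the matrix of $R_x$ in fixed bases as polynomials in $x$, let $p_1,\dots,p_N$ be those that do not vanish identically, let $\mathsf p_\rho$ be their greatest common divisor, write $p_i=\mathsf p_\rho h_i$, and set $\mathsf{Sing}_1=\{x\in V : h_1(x)=\dots=h_N(x)=0\}$. Theorem. Suppose that $\operatorname{trdeg}\mathbb C[V]^{\mathfrak g}=\operatorname{codim}\mathcal O_{\mathrm{reg}}$. Then for every $a\in V$ $$\operatorname{trdeg}Y_a\le\mathsf k_{\mathrm{vert}}(\rho),$$ and equality holds whenever $a\notin\mathsf{Sing}_1$. -/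

import Mathlib

open Module

attribute [local instance 100] LieRing.ofAssociativeRing

noncomputable section

namespace JK

/-! ### Kronecker canonical form of a pencil `A + t B` of linear maps -/

/-- The elementary blocks of the canonical form: a Jordan block of size `n + 1` with eigenvalue `c`,
a Jordan block of size `n + 1` with eigenvalue `∞`, the horizontal Kronecker block of size
`ε × (ε + 1)` and the vertical Kronecker block of size `(η + 1) × η`.  The zero block with `g` rows
and `h` columns is the sum of `g` vertical blocks `1 × 0` and `h` horizontal blocks `0 × 1`. -/
inductive Block : Type
  | jordan (n : ℕ) (c : ℂ) : Block
  | jordanInfty (n : ℕ) : Block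
  | horizontal (ε : ℕ) : Block
  | vertical (η : ℕ) : Block

namespace Block

/-- Number of rows of a block. -/
def rows : Block → ℕ
  | jordan n _ => n + 1
  | jordanInfty n => n + 1
  | horizontal ε => ε
  | vertical η => η + 1

/-- Number of columns of a block. -/
def cols : Block → ℕ
  | jordan n _ => n + 1
  | jordanInfty n => n + 1
  | horizontal ε => ε + 1
  | vertical η => η

/-- The (possibly rectangular) matrix with ones on the main diagonal. -/
def diagOnes (m n : ℕ) : Matrix (Fin m) (Fin n) ℂ :=
  Matrix.of fun i j => if (i : ℕ) = j then 1 else 0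

/-- The (possibly rectangular) matrix with ones just above the main diagonal. -/
def superOnes (m n : ℕ) : Matrix (Fin m) (Fin n) ℂ :=
  Matrix.of fun i j => if (j : ℕ) = i + 1 then 1 else 0

/-- The (possibly rectangular) matrix with ones just below the main diagonal. -/
def subOnes (m n : ℕ) : Matrix (Fin m) (Fin n) ℂ :=
  Matrix.of fun i j => if (i : ℕ) = j + 1 then 1 else 0

/-- The matrix `A` of the block `A + t B`. -/
def matA : (b : Block) → Matrix (Fin b.rows) (Fin b.cols) ℂ
  | jordan n c => c • diagOnes (n + 1) (n + 1) + superOnes (n + 1) (n + 1)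
  | jordanInfty n => diagOnes (n + 1) (n + 1)
  | horizontal ε => diagOnes ε (ε + 1)
  | vertical η => diagOnes (η + 1) η

/-- The matrix `B` of the block `A + t B`. -/
def matB : (b : Block) → Matrix (Fin b.rows) (Fin b.cols) ℂ
  | jordan n _ => diagOnes (n + 1) (n + 1)
  | jordanInfty n => superOnes (n + 1) (n + 1)
  | horizontal ε => superOnes ε (ε + 1)
  | vertical η => subOnes (η + 1) η

/-- The number of rows of a vertical Kronecker block, and `0` for the other blocks. -/
def verticalRows : Block → ℕ
  | vertical η => η + 1
  | _ => 0

end Block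

/-- In suitable bases of `U` and `V` the pencil `A + t B` is block-diagonal with blocks `bs i`. -/
def HasCanonicalForm {U V : Type*} [AddCommGroup U] [Module ℂ U] [AddCommGroup V] [Module ℂ V]
    (A B : U →ₗ[ℂ] V) {N : ℕ} (bs : Fin N → Block) : Prop :=
  ∃ (bU : Basis (Σ i, Fin (bs i).cols) ℂ U) (bV : Basis (Σ i, Fin (bs i).rows) ℂ V),
    LinearMap.toMatrix bU bV A = Matrix.blockDiagonal' (fun i => (bs i).matA) ∧
    LinearMap.toMatrix bU bV B = Matrix.blockDiagonal' (fun i => (bs i).matB)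

/-- The total Kronecker `v`-index of the pencil `A + t B`: the total number of rows in the vertical
Kronecker blocks of its canonical form (which exists and is unique up to the order of blocks). -/
def pencilKVert {U V : Type*} [AddCommGroup U] [Module ℂ U] [AddCommGroup V] [Module ℂ V]
    (A B : U →ₗ[ℂ] V) : ℕ :=
  sInf {k | ∃ (N : ℕ) (bs : Fin N → Block),
    HasCanonicalForm A B bs ∧ k = ∑ i, (bs i).verticalRows}

/-! ### Representations and the operators `R_x` -/

section Representation

variable {𝔤 V : Type*} [LieRing 𝔤] [LieAlgebra ℂ 𝔤] [AddCommGroup V] [Module ℂ V]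

/-- The operator `R_x : 𝔤 → V`, `R_x ξ = ρ(ξ) x`. -/
def R (ρ : 𝔤 →ₗ⁅ℂ⁆ Module.End ℂ V) (x : V) : 𝔤 →ₗ[ℂ] V :=
  (ρ : 𝔤 →ₗ[ℂ] Module.End ℂ V).flip x

/-- The dimension `r = max_x rk R_x` of a regular orbit. -/
def dimOreg (ρ : 𝔤 →ₗ⁅ℂ⁆ Module.End ℂ V) : ℕ :=
  ⨆ x : V, finrank ℂ (LinearMap.range (R ρ x))

/-- The codimension of a regular orbit. -/
def codimOreg (ρ : 𝔤 →ₗ⁅ℂ⁆ Module.End ℂ V) : ℕ :=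
  finrank ℂ V - dimOreg ρ

variable {ι κ : Type*} [Fintype ι] [DecidableEq ι] [Fintype κ] [DecidableEq κ]

/-! The algebra `ℂ[V]` is the ring `MvPolynomial κ ℂ` of polynomials in the linear coordinates
given by a basis `bV` of `V`. -/

/-- The value `f(x)` of `f ∈ ℂ[V]` at `x ∈ V`. -/
def evalAt (bV : Basis κ ℂ V) (x : V) (f : MvPolynomial κ ℂ) : ℂ :=
  MvPolynomial.eval (bV.equivFun x) f

/-- The differential `df(x) ∈ V*`. -/
def diffAt (bV : Basis κ ℂ V) (f : MvPolynomial κ ℂ) (x : V) : Dual ℂ V :=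
  ∑ k, evalAt bV x (MvPolynomial.pderiv k f) • bV.coord k

/-- The algebra `ℂ[V]^𝔤` of polynomial invariants: `R_x^* (df(x)) = 0` for all `x`. -/
def invariants (ρ : 𝔤 →ₗ⁅ℂ⁆ Module.End ℂ V) (bV : Basis κ ℂ V) :
    Subalgebra ℂ (MvPolynomial κ ℂ) where
  carrier := {f | ∀ x : V, (R ρ x).dualMap (diffAt bV f x) = 0}
  mul_mem' := by
    intro f g hf hg x
    have h : diffAt bV (f * g) x
        = evalAt bV x f • diffAt bV g x + evalAt bV x g • diffAt bV f x := by
      simp only [diffAt, Finset.smul_sum, ← Finset.sum_add_distrib, smul_smul, ← add_smul]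
      refine Finset.sum_congr rfl fun k _ => ?_
      simp only [evalAt, Derivation.leibniz, smul_eq_mul, map_add, map_mul]
    rw [h, map_add, map_smul, map_smul, hf x, hg x]
    simp
  add_mem' := by
    intro f g hf hg x
    have h : diffAt bV (f + g) x = diffAt bV f x + diffAt bV g x := by
      simp [diffAt, evalAt, add_smul, Finset.sum_add_distrib]
    rw [h, map_add, hf x, hg x, add_zero]
  algebraMap_mem' := by
    intro c x
    have h : diffAt bV (algebraMap ℂ (MvPolynomial κ ℂ) c) x = 0 := by
      simp [diffAt, evalAt]
    rw [h, map_zero]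

/-- The polynomial `x ↦ f(x + v)`. -/
def shift (bV : Basis κ ℂ V) (v : V) (f : MvPolynomial κ ℂ) : MvPolynomial κ ℂ :=
  MvPolynomial.aeval (fun k => MvPolynomial.X k + MvPolynomial.C (bV.equivFun v k)) f

/-- The subalgebra `Y_a ⊆ ℂ[V]` generated by the shifts `f(x + t a)`, `f ∈ ℂ[V]^𝔤`, `t ∈ ℂ`. -/
def Y (ρ : 𝔤 →ₗ⁅ℂ⁆ Module.End ℂ V) (bV : Basis κ ℂ V) (a : V) :
    Subalgebra ℂ (MvPolynomial κ ℂ) :=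
  Algebra.adjoin ℂ {p | ∃ f ∈ invariants ρ bV, ∃ t : ℂ, p = shift bV (t • a) f}

/-- Zariski open subsets of `V × V`. -/
def IsZariskiOpen (bV : Basis κ ℂ V) (S : Set (V × V)) : Prop :=
  ∃ P : Set (MvPolynomial (κ ⊕ κ) ℂ), S = {z | ∃ F ∈ P,
    MvPolynomial.eval (Sum.elim (bV.equivFun z.1) (bV.equivFun z.2)) F ≠ 0}

/-- The total Kronecker `v`-index of `ρ`: the value of the total Kronecker `v`-index of the pencil
`R_x + t R_a` for generic `(x, a)`, i.e. on a non-empty Zariski open subset of `V × V`. -/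
def kVert (ρ : 𝔤 →ₗ⁅ℂ⁆ Module.End ℂ V) (bV : Basis κ ℂ V) : ℕ :=
  sInf {k | ∃ S : Set (V × V), IsZariskiOpen bV S ∧ S.Nonempty ∧
    ∀ z ∈ S, pencilKVert (R ρ z.1) (R ρ z.2) = k}

/-- The matrix of `R_x` with entries considered as (linear) polynomials in `x`. -/
def genMatrix (ρ : 𝔤 →ₗ⁅ℂ⁆ Module.End ℂ V) (b𝔤 : Basis ι ℂ 𝔤) (bV : Basis κ ℂ V) :
    Matrix κ ι (MvPolynomial κ ℂ) :=
  Matrix.of fun k i => ∑ j, MvPolynomial.C (LinearMap.toMatrix b𝔤 bV (R ρ (bV j)) k i) *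
    MvPolynomial.X j

/-- The minors of the matrix of `R_x` of size `r × r`, `r = dim O_reg`, as polynomials in `x`. -/
def minor (ρ : 𝔤 →ₗ⁅ℂ⁆ Module.End ℂ V) (b𝔤 : Basis ι ℂ 𝔤) (bV : Basis κ ℂ V)
    (s : Fin (dimOreg ρ) ↪ κ) (t : Fin (dimOreg ρ) ↪ ι) : MvPolynomial κ ℂ :=
  ((genMatrix ρ b𝔤 bV).submatrix s t).det

/-- `p` is a greatest common divisor `p_ρ` of all `r × r` minors of the matrix of `R_x`. -/
def IsFundamentalSemiInvariant (ρ : 𝔤 →ₗ⁅ℂ⁆ Module.End ℂ V) (b𝔤 : Basis ι ℂ 𝔤)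
    (bV : Basis κ ℂ V) (p : MvPolynomial κ ℂ) : Prop :=
  (∀ s t, p ∣ minor ρ b𝔤 bV s t) ∧
    ∀ q : MvPolynomial κ ℂ, (∀ s t, q ∣ minor ρ b𝔤 bV s t) → q ∣ p

/-- The set `Sing₁` of common zeros of the quotients of the `r × r` minors by their greatest
common divisor `p_ρ` (which exists and is unique up to a non-zero constant). -/
def Sing₁ (ρ : 𝔤 →ₗ⁅ℂ⁆ Module.End ℂ V) (b𝔤 : Basis ι ℂ 𝔤) (bV : Basis κ ℂ V) : Set V :=
  {x | ∃ p, IsFundamentalSemiInvariant ρ b𝔤 bV p ∧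
    ∀ s t h, minor ρ b𝔤 bV s t = p * h → evalAt bV x h = 0}

end Representation

end JK

end

/-! By the Jacobian criterion (`exists_trdeg_le_finrank_grad`, `finrank_grad_le_trdeg`), trdeg Y_a
is the dimension of the span of the differentials of Y_a at a generic x, and that span consists of
the combinations of the covectors df(x + λa), f invariant (`diffSpan`). The hypothesis on invariants
makes the df(y) span ker R_y^* at generic y (`exists_span_diffAt_eq_ker`). On the other hand, for
all but finitely many λ the kernel of (R_x + λR_a)^* is spanned by polynomial curves in λ, one of
degree η for each vertical block with η + 1 rows, and the coefficients of all these curves are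
jointly linearly independent (`exists_minimal_left_kernel_basis`). Comparing both descriptions at
infinitely many λ shows that, for generic x and every a, dim `diffSpan` is the total v-index of R_x
+ λR_a (`pencilKVert_eq_finrank_diffSpan`). This dimension is lower semicontinuous in (x, a), so its
generic value `kVert` is its maximum; hence the inequality.

For equality the generic value must be reached with the given a. Fix r columns containing a minor
that is not identically zero, and write the r × r minors in these columns, up to sign, as g α_e with
coprime α_e; all α_e are homogeneous of one degree d. On the line x + λa they are proportional to
the complementary minors δ_e of the matrix of kernel curves. The δ_e have no common root and maximal
degree D = (total v-index) − s, where s = codim O_reg. So α_e(x + λa) = q δ_e, and D ≤ d. If a ∉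
Sing₁, then some α_e(a) ≠ 0, so α_e(x + λa) has degree exactly d; and the common zeros of coprime
polynomials have codimension at least 2, so a generic line of direction a avoids them and q is
constant. Then D = d. Thus s + d bounds the generic index and is attained for such a
(`exists_pencilKVert_bound`).

The kernel curves come from the Kronecker canonical form, whose existence is proved by induction: a
pencil A, B : U → V with im A + im B = V is replaced by the two projections to U of {(x, y) : Ax =
By}, and blocks are lifted back (`isBlockSum_of_reflect`). Pencils with some A + cB bijective reduce
to the Jordan form. -/

noncomputable section

namespace JK

/-! ### Direct sums of elementary blocks -/

section BlockSum

variable {U V U' V' : Type*} [AddCommGroup U] [Module ℂ U] [AddCommGroup V] [Module ℂ V]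
  [AddCommGroup U'] [Module ℂ U'] [AddCommGroup V'] [Module ℂ V']

/-- The bases `bU`, `bV` bring the pencil `A + t B` to block-diagonal form with blocks `bs i`. -/
def IsBlockBasis (A B : U →ₗ[ℂ] V) {I : Type} (bs : I → Block)
    (bU : Basis (Σ i, Fin (bs i).cols) ℂ U) (bV : Basis (Σ i, Fin (bs i).rows) ℂ V) : Prop :=
  ∀ i j, A (bU ⟨i, j⟩) = ∑ k, (bs i).matA k j • bV ⟨i, k⟩ ∧
    B (bU ⟨i, j⟩) = ∑ k, (bs i).matB k j • bV ⟨i, k⟩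

/-- The pencil `A + t B` is a finite direct sum of elementary blocks. -/
def IsBlockSum (A B : U →ₗ[ℂ] V) : Prop :=
  ∃ (I : Type) (_ : Fintype I) (bs : I → Block)
    (bU : Basis (Σ i, Fin (bs i).cols) ℂ U) (bV : Basis (Σ i, Fin (bs i).rows) ℂ V),
    IsBlockBasis A B bs bU bV

theorem toMatrix_eq_blockDiagonal'_iff {I : Type} [Fintype I] [DecidableEq I] {m n : I → ℕ}
    (bU : Basis (Σ i, Fin (n i)) ℂ U) (bV : Basis (Σ i, Fin (m i)) ℂ V) (A : U →ₗ[ℂ] V)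
    (M : ∀ i, Matrix (Fin (m i)) (Fin (n i)) ℂ) :
    LinearMap.toMatrix bU bV A = Matrix.blockDiagonal' M ↔
      ∀ i j, A (bU ⟨i, j⟩) = ∑ k, M i k j • bV ⟨i, k⟩ := by
  have key : ∀ i j, ∑ p : Σ i, Fin (m i), Matrix.blockDiagonal' M p ⟨i, j⟩ • bV p
      = ∑ k, M i k j • bV ⟨i, k⟩ := by
    intro i j
    rw [Fintype.sum_sigma, Finset.sum_eq_single i]
    · simp [Matrix.blockDiagonal'_apply_eq]
    · intro i' _ hne
      refine Finset.sum_eq_zero fun k _ => ?_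
      rw [Matrix.blockDiagonal'_apply_ne _ _ _ hne, zero_smul]
    · simp
  constructor
  · intro h i j
    rw [← key, ← h]
    simp only [LinearMap.toMatrix_apply]
    exact (bV.sum_repr _).symm
  · intro h
    ext p ⟨i, j⟩
    rw [LinearMap.toMatrix_apply, h, ← key, bV.repr_sum_self]

theorem hasCanonicalForm_iff (A B : U →ₗ[ℂ] V) {N : ℕ} (bs : Fin N → Block) :
    HasCanonicalForm A B bs ↔ ∃ bU bV, IsBlockBasis A B bs bU bV := by
  simp only [HasCanonicalForm, IsBlockBasis, toMatrix_eq_blockDiagonal'_iff, forall_and]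

theorem IsBlockSum.exists_hasCanonicalForm {A B : U →ₗ[ℂ] V} (h : IsBlockSum A B) :
    ∃ (N : ℕ) (bs : Fin N → Block), HasCanonicalForm A B bs := by
  obtain ⟨I, _, bs, bU, bV, hb⟩ := h
  let e : Fin (Fintype.card I) ≃ I := (Fintype.equivFin I).symm
  refine ⟨Fintype.card I, bs ∘ e, (hasCanonicalForm_iff _ _ _).2 ?_⟩
  refine ⟨bU.reindex (Equiv.sigmaCongrLeft (β := fun i => Fin (bs i).cols) e).symm,
    bV.reindex (Equiv.sigmaCongrLeft (β := fun i => Fin (bs i).rows) e).symm, ?_⟩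
  intro i j
  simpa using hb (e i) j

theorem IsBlockSum.of_equiv {A B : U →ₗ[ℂ] V} {A' B' : U' →ₗ[ℂ] V'} (h : IsBlockSum A B)
    (e : U ≃ₗ[ℂ] U') (f : V ≃ₗ[ℂ] V') (hA : ∀ u, A' (e u) = f (A u))
    (hB : ∀ u, B' (e u) = f (B u)) : IsBlockSum A' B' := by
  obtain ⟨I, _, bs, bU, bV, hb⟩ := h
  refine ⟨I, ‹_›, bs, bU.map e, bV.map f, fun i j => ?_⟩
  simp only [Basis.map_apply, hA, hB, (hb i j).1, (hb i j).2, map_sum, map_smul, and_self]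

theorem exists_basis_sigma_prod {I I' : Type} {n : I ⊕ I' → ℕ}
    (b : Basis (Σ i, Fin (n (.inl i))) ℂ U) (b' : Basis (Σ i, Fin (n (.inr i))) ℂ U') :
    ∃ c : Basis (Σ i, Fin (n i)) ℂ (U × U'),
      (∀ i j, c ⟨.inl i, j⟩ = (b ⟨i, j⟩, 0)) ∧ ∀ i j, c ⟨.inr i, j⟩ = (0, b' ⟨i, j⟩) := by
  refine ⟨(b.prod b').reindex (Equiv.sumSigmaDistrib fun i => Fin (n i)).symm, ?_, ?_⟩ <;>
  · intro i j
    simp [Basis.prod_apply]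

theorem IsBlockSum.prodMap {A B : U →ₗ[ℂ] V} {A' B' : U' →ₗ[ℂ] V'} (h : IsBlockSum A B)
    (h' : IsBlockSum A' B') : IsBlockSum (A.prodMap A') (B.prodMap B') := by
  obtain ⟨I, _, bs, bU, bV, hb⟩ := h
  obtain ⟨I', _, bs', bU', bV', hb'⟩ := h'
  obtain ⟨cU, hU, hU'⟩ := exists_basis_sigma_prod (n := fun i => (Sum.elim bs bs' i).cols) bU bU'
  obtain ⟨cV, hV, hV'⟩ := exists_basis_sigma_prod (n := fun i => (Sum.elim bs bs' i).rows) bV bV'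
  refine ⟨I ⊕ I', inferInstance, Sum.elim bs bs', cU, cV, ?_⟩
  rintro (i | i) j
  · rw [hU]
    simp only [hV, LinearMap.prodMap_apply, map_zero]
    constructor
    · refine Prod.ext ((hb i j).1.trans ?_) ?_ <;> simp [Prod.fst_sum, Prod.snd_sum]
      rfl
    · refine Prod.ext ((hb i j).2.trans ?_) ?_ <;> simp [Prod.fst_sum, Prod.snd_sum]
      rfl
  · rw [hU']
    simp only [hV', LinearMap.prodMap_apply, map_zero]
    constructor
    · refine Prod.ext ?_ ((hb' i j).1.trans ?_) <;> simp [Prod.fst_sum, Prod.snd_sum]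
      rfl
    · refine Prod.ext ?_ ((hb' i j).2.trans ?_) <;> simp [Prod.fst_sum, Prod.snd_sum]
      rfl

theorem IsBlockSum.of_isCompl {A B : U →ₗ[ℂ] V} {U₀ U₁ : Submodule ℂ U} {V₀ V₁ : Submodule ℂ V}
    (hU : IsCompl U₀ U₁) (hV : IsCompl V₀ V₁)
    (hA₀ : ∀ u ∈ U₀, A u ∈ V₀) (hB₀ : ∀ u ∈ U₀, B u ∈ V₀)
    (hA₁ : ∀ u ∈ U₁, A u ∈ V₁) (hB₁ : ∀ u ∈ U₁, B u ∈ V₁)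
    (h₀ : IsBlockSum (A.restrict hA₀) (B.restrict hB₀))
    (h₁ : IsBlockSum (A.restrict hA₁) (B.restrict hB₁)) : IsBlockSum A B := by
  refine (h₀.prodMap h₁).of_equiv (Submodule.prodEquivOfIsCompl _ _ hU)
    (Submodule.prodEquivOfIsCompl _ _ hV) ?_ ?_ <;> rintro ⟨u, v⟩ <;> simp

/-- With no columns, the pencil is a sum of dim V vertical blocks of size 1 × 0. -/
theorem isBlockSum_of_subsingleton [Subsingleton U] [FiniteDimensional ℂ V] (A B : U →ₗ[ℂ] V) :
    IsBlockSum A B := by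
  let bV := Module.finBasis ℂ V
  refine ⟨Fin (finrank ℂ V), inferInstance, fun _ => .vertical 0, ?_, ?_, ?_⟩
  · haveI : IsEmpty (Σ _ : Fin (finrank ℂ V), Fin (Block.vertical 0).cols) :=
      ⟨fun p => Fin.elim0 p.2⟩
    exact Basis.empty U
  · haveI : Unique (Fin (0 + 1)) := inferInstanceAs (Unique (Fin 1))
    exact bV.reindex (Equiv.sigmaUnique (Fin (finrank ℂ V)) (fun _ => Fin (0 + 1))).symm
  · intro i j
    exact Fin.elim0 j

end BlockSum

/-! ### Duality -/

namespace Block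

/-- The transposed block. -/
def transpose : Block → Block
  | jordan n c => jordan n c
  | jordanInfty n => jordanInfty n
  | horizontal ε => vertical ε
  | vertical η => horizontal η

/-- Rows of the transposed block correspond to columns of the block. -/
def rowsEquiv : (b : Block) → Fin b.transpose.rows ≃ Fin b.cols
  | jordan _ _ => Fin.revPerm
  | jordanInfty _ => Fin.revPerm
  | horizontal _ => Equiv.refl _
  | vertical _ => Equiv.refl _

/-- Columns of the transposed block correspond to rows of the block. -/
def colsEquiv : (b : Block) → Fin b.transpose.cols ≃ Fin b.rows
  | jordan _ _ => Fin.revPerm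
  | jordanInfty _ => Fin.revPerm
  | horizontal _ => Equiv.refl _
  | vertical _ => Equiv.refl _

theorem diagOnes_rev {n : ℕ} (i j : Fin n) :
    diagOnes n n (Fin.rev i) (Fin.rev j) = diagOnes n n j i := by
  simp only [diagOnes, Matrix.of_apply, Fin.val_rev]
  congr 1
  apply propext; omega

theorem superOnes_rev {n : ℕ} (i j : Fin n) :
    superOnes n n (Fin.rev i) (Fin.rev j) = superOnes n n j i := by
  simp only [superOnes, Matrix.of_apply, Fin.val_rev]
  congr 1
  apply propext; omega

theorem matA_transpose (b : Block) (i : Fin b.transpose.rows) (j : Fin b.transpose.cols) :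
    b.transpose.matA i j = b.matA (b.colsEquiv j) (b.rowsEquiv i) := by
  cases b with
  | jordan n c =>
    exact congrArg₂ (fun x y => c • x + y) (diagOnes_rev j i).symm (superOnes_rev j i).symm
  | jordanInfty n => exact (diagOnes_rev j i).symm
  | horizontal ε => exact if_congr eq_comm rfl rfl
  | vertical η => exact if_congr eq_comm rfl rfl

theorem matB_transpose (b : Block) (i : Fin b.transpose.rows) (j : Fin b.transpose.cols) :
    b.transpose.matB i j = b.matB (b.colsEquiv j) (b.rowsEquiv i) := by
  cases b with
  | jordan n c => exact (diagOnes_rev j i).symm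
  | jordanInfty n => exact (superOnes_rev j i).symm
  | horizontal ε => rfl
  | vertical η => rfl

end Block

section Dual

variable {U V : Type*} [AddCommGroup U] [Module ℂ U] [AddCommGroup V] [Module ℂ V]

theorem dualMap_dualBasis_eq_sum {I : Type} [Fintype I] [DecidableEq I] {m n : I → ℕ}
    (bU : Basis (Σ i, Fin (n i)) ℂ U) (bV : Basis (Σ i, Fin (m i)) ℂ V) (A : U →ₗ[ℂ] V)
    (M : ∀ i, Matrix (Fin (m i)) (Fin (n i)) ℂ)
    (h : ∀ i j, A (bU ⟨i, j⟩) = ∑ k, M i k j • bV ⟨i, k⟩) (i : I) (k : Fin (m i)) :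
    A.dualMap (bV.dualBasis ⟨i, k⟩) = ∑ j, M i k j • bU.dualBasis ⟨i, j⟩ := by
  refine bU.ext ?_
  rintro ⟨i', j'⟩
  simp only [LinearMap.dualMap_apply, h, map_sum, map_smul, Basis.dualBasis_apply_self,
    LinearMap.sum_apply, LinearMap.smul_apply, smul_eq_mul, mul_ite, mul_one, mul_zero]
  by_cases hi : i' = i
  · subst hi
    simp
  · have h1 : ∀ x : Fin (m i'), (⟨i', x⟩ : Σ i, Fin (m i)) ≠ ⟨i, k⟩ := by
      intro x hx; exact hi (congrArg Sigma.fst hx)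
    have h2 : ∀ x : Fin (n i), (⟨i', j'⟩ : Σ i, Fin (n i)) ≠ ⟨i, x⟩ := by
      intro x hx; exact hi (congrArg Sigma.fst hx)
    simp [h1, h2]

/-- In the dual bases the blocks are transposed; reversing the order of the basis turns a transposed
Jordan block back into a Jordan block, while vertical and horizontal blocks are exchanged. -/
theorem IsBlockSum.dualMap {A B : U →ₗ[ℂ] V} (h : IsBlockSum A B) :
    IsBlockSum A.dualMap B.dualMap := by
  classical
  obtain ⟨I, _, bs, bU, bV, hb⟩ := h
  refine ⟨I, ‹_›, fun i => (bs i).transpose,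
    bV.dualBasis.reindex (Equiv.sigmaCongrRight fun i => (bs i).colsEquiv).symm,
    bU.dualBasis.reindex (Equiv.sigmaCongrRight fun i => (bs i).rowsEquiv).symm, fun i k => ?_⟩
  simp only [Basis.reindex_apply, Equiv.symm_symm, Equiv.sigmaCongrRight_apply,
    Block.matA_transpose, Block.matB_transpose]
  constructor
  · rw [dualMap_dualBasis_eq_sum bU bV A _ fun i j => (hb i j).1]
    exact ((bs i).rowsEquiv.sum_comp
      fun j => (bs i).matA ((bs i).colsEquiv k) j • bU.dualBasis ⟨i, j⟩).symm
  · rw [dualMap_dualBasis_eq_sum bU bV B _ fun i j => (hb i j).2]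
    exact ((bs i).rowsEquiv.sum_comp
      fun j => (bs i).matB ((bs i).colsEquiv k) j • bU.dualBasis ⟨i, j⟩).symm

theorem isBlockSum_of_dualMap [FiniteDimensional ℂ U] [FiniteDimensional ℂ V] {A B : U →ₗ[ℂ] V}
    (h : IsBlockSum A.dualMap B.dualMap) : IsBlockSum A B :=
  h.dualMap.of_equiv (evalEquiv ℂ U).symm (evalEquiv ℂ V).symm
    (fun u => by
      obtain ⟨u, rfl⟩ := (evalEquiv ℂ U).surjective u
      rw [LinearEquiv.symm_apply_apply, LinearEquiv.eq_symm_apply]; rfl)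
    (fun u => by
      obtain ⟨u, rfl⟩ := (evalEquiv ℂ U).surjective u
      rw [LinearEquiv.symm_apply_apply, LinearEquiv.eq_symm_apply]; rfl)

end Dual

/-! ### Reflection of pencils -/

namespace Block

variable {W : Type*} [AddCommGroup W] [Module ℂ W]

theorem sum_ite_smul {m : ℕ} (f : Fin m → W) (P : Fin m → Prop) [DecidablePred P] (i : Fin m)
    (h : ∀ k, P k ↔ k = i) : ∑ k, (if P k then (1 : ℂ) else 0) • f k = f i := by
  simp [h]

theorem sum_diagOnes_smul {m n : ℕ} (f : Fin m → W) (j : Fin n) (i : Fin m) (h : (i : ℕ) = j) :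
    ∑ k, diagOnes m n k j • f k = f i :=
  sum_ite_smul f _ i fun k => by rw [Fin.ext_iff, h]

theorem sum_subOnes_smul {m n : ℕ} (f : Fin m → W) (j : Fin n) (i : Fin m)
    (h : (i : ℕ) = j + 1) : ∑ k, subOnes m n k j • f k = f i :=
  sum_ite_smul f _ i fun k => by rw [Fin.ext_iff, h]

theorem sum_superOnes_smul {m n : ℕ} (f : Fin m → W) (j : Fin n) (i : Fin m)
    (h : (j : ℕ) = i + 1) : ∑ k, superOnes m n k j • f k = f i :=
  sum_ite_smul f _ i fun k => by rw [Fin.ext_iff, h]; omega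

end Block

section Reflection

variable {U V : Type*} [AddCommGroup U] [Module ℂ U] [AddCommGroup V] [Module ℂ V]

-- One block of the reflected pencil determines one block of the original: Jordan blocks are kept,
-- vertical η comes from vertical η + 1, and horizontal ε + 1 from horizontal ε. The relation on
-- sizes is what makes the new vectors number exactly dim V.
open Block in
theorem exists_reflected_block (A B : U →ₗ[ℂ] V) (b : Block) (hb : b ≠ .horizontal 0)
    (u : Fin b.rows → U)
    (h : ∀ j, A (∑ k, b.matB k j • u k) = B (∑ k, b.matA k j • u k)) :
    ∃ (b' : Block) (e : Fin b'.cols ≃ Fin b.rows) (f : Fin b'.rows → V),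
      b'.rows + b.cols = 2 * b.rows ∧ ∀ j, A (u (e j)) = ∑ k, b'.matA k j • f k ∧
        B (u (e j)) = ∑ k, b'.matB k j • f k := by
  cases b with
  | jordan n c =>
    refine ⟨jordan n c, Equiv.refl _, fun j => B (u j), (two_mul _).symm, fun j => ⟨?_, ?_⟩⟩
    · have h1 := h j
      rw [map_sum B] at h1
      simp only [map_smul] at h1
      rw [← h1]
      exact congrArg A (sum_diagOnes_smul u j j rfl).symm
    · exact (sum_diagOnes_smul (fun j => B (u j)) j j rfl).symm
  | jordanInfty n =>
    refine ⟨jordanInfty n, Equiv.refl _, fun j => A (u j), (two_mul _).symm, fun j => ⟨?_, ?_⟩⟩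
    · exact (sum_diagOnes_smul (fun j => A (u j)) j j rfl).symm
    · have h1 := h j
      rw [map_sum A] at h1
      simp only [map_smul] at h1
      refine Eq.trans ?_ h1.symm
      exact congrArg B (sum_diagOnes_smul u j j rfl).symm
  | vertical η =>
    let f : Fin (η + 2) → V := Fin.cons (A (u (0 : Fin (η + 1)))) fun k : Fin (η + 1) => B (u k)
    refine ⟨vertical (η + 1), Equiv.refl _, f, by simp only [rows, cols]; omega,
      fun j => ⟨?_, ?_⟩⟩
    · refine Eq.trans ?_ (sum_diagOnes_smul f j (Fin.castSucc j) rfl).symm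
      refine Fin.cases (motive := fun j : Fin (η + 1) => A (u j) = f (Fin.castSucc j)) rfl ?_ j
      intro k
      have h1 := h k
      have h2 := sum_subOnes_smul (W := U) u k k.succ rfl
      have h3 := sum_diagOnes_smul (W := U) u k k.castSucc rfl
      exact (congrArg A h2).symm.trans (h1.trans (congrArg B h3))
    · exact (sum_subOnes_smul f j (Fin.succ j) rfl).symm
  | horizontal ε =>
    cases ε with
    | zero => exact absurd rfl hb
    | succ ε =>
      have hlast : A (u (Fin.last ε)) = 0 := by
        have h1 := h (Fin.last (ε + 1))
        have h2 := sum_superOnes_smul (W := U) u (Fin.last (ε + 1)) (Fin.last ε) rfl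
        have h3 : ∑ k, diagOnes (ε + 1) (ε + 2) k (Fin.last (ε + 1)) • u k = 0 :=
          Finset.sum_eq_zero fun k _ => by
            rw [diagOnes, Matrix.of_apply, if_neg, zero_smul]
            exact (Nat.ne_of_lt k.2)
        exact (congrArg A h2).symm.trans (h1.trans ((congrArg B h3).trans (map_zero B)))
      refine ⟨horizontal ε, Equiv.refl _, fun k => A (u (Fin.castSucc k)),
        by simp only [rows, cols]; omega, fun j => ⟨?_, ?_⟩⟩
      · have h1 := sum_diagOnes_smul (fun k : Fin (ε + 1) => A (u k)) j j rfl
        rw [Fin.sum_univ_castSucc, hlast, smul_zero, add_zero] at h1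
        exact h1.symm
      · have h1 := h (Fin.castSucc j)
        rw [map_sum A] at h1
        simp only [map_smul] at h1
        have h2 := sum_diagOnes_smul (W := U) u (Fin.castSucc j) j rfl
        refine (congrArg B h2).symm.trans (h1.symm.trans ?_)
        refine (Fin.sum_univ_castSucc (n := ε) _).trans ?_
        rw [hlast, smul_zero, add_zero]
        rfl

/-- The space of pairs `(x, y)` with `A x = B y`. -/
def reflectSpace (A B : U →ₗ[ℂ] V) : Submodule ℂ (U × U) :=
  LinearMap.ker (A ∘ₗ LinearMap.fst ℂ U U - B ∘ₗ LinearMap.snd ℂ U U)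

/-- The map `(x, y) ↦ y` of the reflected pencil. -/
def reflectA (A B : U →ₗ[ℂ] V) : reflectSpace A B →ₗ[ℂ] U :=
  LinearMap.snd ℂ U U ∘ₗ (reflectSpace A B).subtype

/-- The map `(x, y) ↦ x` of the reflected pencil. -/
def reflectB (A B : U →ₗ[ℂ] V) : reflectSpace A B →ₗ[ℂ] U :=
  LinearMap.fst ℂ U U ∘ₗ (reflectSpace A B).subtype

theorem apply_reflectB (A B : U →ₗ[ℂ] V) (w : reflectSpace A B) :
    A (reflectB A B w) = B (reflectA A B w) :=
  sub_eq_zero.1 w.2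

theorem finrank_reflectSpace [FiniteDimensional ℂ U] [FiniteDimensional ℂ V] {A B : U →ₗ[ℂ] V}
    (h : LinearMap.range A ⊔ LinearMap.range B = ⊤) :
    finrank ℂ V + finrank ℂ (reflectSpace A B) = 2 * finrank ℂ U := by
  have h1 := LinearMap.finrank_range_add_finrank_ker
    (A ∘ₗ LinearMap.fst ℂ U U - B ∘ₗ LinearMap.snd ℂ U U)
  have h2 : LinearMap.range (A ∘ₗ LinearMap.fst ℂ U U - B ∘ₗ LinearMap.snd ℂ U U) = ⊤ := by
    rw [eq_top_iff, ← h, sup_le_iff]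
    constructor
    · rintro _ ⟨x, rfl⟩
      exact ⟨(x, 0), by simp⟩
    · rintro _ ⟨x, rfl⟩
      exact ⟨(0, -x), by simp⟩
  rw [h2, finrank_top, finrank_prod] at h1
  rw [reflectSpace]
  omega

/-- The lifted blocks use the same basis of U, and their row vectors span im A + im B = V; a
dimension count then makes them a basis. -/
theorem isBlockSum_of_reflect [FiniteDimensional ℂ U] [FiniteDimensional ℂ V] {A B : U →ₗ[ℂ] V}
    (hAB : LinearMap.range A ⊔ LinearMap.range B = ⊤)
    (h : IsBlockSum (reflectA A B) (reflectB A B)) : IsBlockSum A B := by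
  obtain ⟨I, _, bs, bW, bU, hb⟩ := h
  -- A 0 × 1 block would be a non-zero pair (x, y) with both components zero.
  have hne : ∀ i, bs i ≠ .horizontal 0 := by
    intro i hi
    have key : ∀ b : Block, b = .horizontal 0 → ∃ j : Fin b.cols, IsEmpty (Fin b.rows) := by
      rintro _ rfl
      exact ⟨(0 : Fin 1), inferInstanceAs (IsEmpty (Fin 0))⟩
    obtain ⟨j, hj⟩ := key (bs i) hi
    have h1 := hb i j
    simp only [Finset.univ_eq_empty, Finset.sum_empty] at h1
    exact bW.ne_zero ⟨i, j⟩ (Subtype.ext (Prod.ext h1.2 h1.1))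
  have hblock := fun i => exists_reflected_block A B (bs i) (hne i) (fun k => bU ⟨i, k⟩)
    fun j => by rw [← (hb i j).1, ← (hb i j).2]; exact apply_reflectB A B _
  choose b' e f hdim hf using hblock
  let cU : Basis (Σ i, Fin (b' i).cols) ℂ U := bU.reindex (Equiv.sigmaCongrRight e).symm
  have hcU : ∀ i j, cU ⟨i, j⟩ = bU ⟨i, e i j⟩ := fun i j => by simp [cU]
  let F : (Σ i, Fin (b' i).rows) → V := fun p => f p.1 p.2
  have hspan : ⊤ ≤ Submodule.span ℂ (Set.range F) := by
    have hmem : ∀ i k, F ⟨i, k⟩ ∈ Submodule.span ℂ (Set.range F) := fun i k =>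
      Submodule.subset_span ⟨_, rfl⟩
    rw [← hAB, sup_le_iff, ← Submodule.map_top, ← Submodule.map_top, ← cU.span_eq,
      Submodule.map_span, Submodule.map_span, Submodule.span_le, Submodule.span_le]
    constructor <;>
    · rintro _ ⟨_, ⟨⟨i, j⟩, rfl⟩, rfl⟩
      rw [hcU]
      first | rw [(hf i j).1] | rw [(hf i j).2]
      exact Submodule.sum_mem _ fun k _ => Submodule.smul_mem _ _ (hmem i k)
  have hcard : Fintype.card (Σ i, Fin (b' i).rows) = finrank ℂ V := by
    have h1 := finrank_reflectSpace hAB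
    have h2 := finrank_eq_card_basis bW
    have h3 := finrank_eq_card_basis bU
    have h4 : ∑ i, ((b' i).rows + (bs i).cols) = ∑ i, 2 * (bs i).rows :=
      Finset.sum_congr rfl fun i _ => hdim i
    rw [Finset.sum_add_distrib, ← Finset.mul_sum] at h4
    simp only [Fintype.card_sigma, Fintype.card_fin] at h2 h3 ⊢
    omega
  refine ⟨I, ‹_›, b', cU, basisOfTopLeSpanOfCardEqFinrank F hspan hcard, fun i j => ?_⟩
  rw [coe_basisOfTopLeSpanOfCardEqFinrank, hcU]
  exact hf i j

end Reflection

/-! ### The Jordan normal form -/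

section Jordan

open Polynomial

theorem dfinsupp_basis_apply {ι R : Type*} {M η : ι → Type*} [DecidableEq ι] [Semiring R]
    [∀ i, AddCommMonoid (M i)] [∀ i, Module R (M i)] (b : ∀ i, Basis (η i) R (M i)) (i : ι)
    (j : η i) : DFinsupp.basis b ⟨i, j⟩ = DFinsupp.single i (b i j) := by
  classical
  apply (DFinsupp.basis b).repr.injective
  rw [Basis.repr_self]
  refine ((sigmaFinsuppLequivDFinsupp R).symm_apply_eq.2 ?_).symm
  change _ = sigmaFinsuppEquivDFinsupp (Finsupp.single ⟨i, j⟩ (1 : R))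
  rw [sigmaFinsuppEquivDFinsupp_single]
  refine (DFinsupp.mapRange_single (hf := fun i => map_zero (b i).repr)).trans ?_
  rw [Basis.repr_self]

/-- The basis consists of the powers of X − c in decreasing order, so that multiplication by X − c
moves each vector to the previous one, as the superdiagonal convention requires. -/
theorem exists_basis_quotient_X_sub_C_pow (c : ℂ) (e : ℕ) :
    ∃ b : Basis (Fin e) ℂ (ℂ[X] ⧸ Submodule.span ℂ[X] {(X - C c) ^ e}),
      ∀ j, (X : ℂ[X]) • b j
        = ∑ k, (c • Block.diagOnes e e + Block.superOnes e e) k j • b k := by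
  have hmonic : ((X - C c) ^ e).Monic := (monic_X_sub_C c).pow e
  let F : Fin e → ℂ[X] ⧸ Submodule.span ℂ[X] {(X - C c) ^ e} := fun j =>
    Submodule.Quotient.mk ((X - C c) ^ (e - 1 - j))
  have hzero : ∀ k, e ≤ k → (Submodule.Quotient.mk ((X - C c) ^ k) :
      ℂ[X] ⧸ Submodule.span ℂ[X] {(X - C c) ^ e}) = 0 := fun k hk => by
    rw [Submodule.Quotient.mk_eq_zero]
    exact Ideal.mem_span_singleton.2 (pow_dvd_pow _ hk)
  have hspan : ⊤ ≤ Submodule.span ℂ (Set.range F) := by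
    rintro q -
    obtain ⟨f, rfl⟩ := Submodule.Quotient.mk_surjective _ q
    rw [← sum_taylor_eq f c, Polynomial.sum, ← Submodule.mkQ_apply, map_sum]
    refine Submodule.sum_mem _ fun k _ => ?_
    rw [← smul_eq_C_mul, Submodule.mkQ_apply, Submodule.Quotient.mk_smul]
    refine Submodule.smul_mem _ _ ?_
    by_cases hk : e ≤ k
    · rw [hzero k hk]; exact Submodule.zero_mem _
    · refine Submodule.subset_span ⟨⟨e - 1 - k, by omega⟩, ?_⟩
      simp only [F]
      congr 2
      omega
  have hcard : Fintype.card (Fin e) =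
      finrank ℂ (ℂ[X] ⧸ Submodule.span ℂ[X] {(X - C c) ^ e}) := by
    have h1 := (AdjoinRoot.powerBasis hmonic.ne_zero).finrank
    rw [AdjoinRoot.powerBasis_dim, natDegree_pow, natDegree_X_sub_C, mul_one] at h1
    rw [Fintype.card_fin]
    exact h1.symm
  refine ⟨basisOfTopLeSpanOfCardEqFinrank F hspan hcard, fun j => ?_⟩
  rw [coe_basisOfTopLeSpanOfCardEqFinrank]
  simp only [Matrix.add_apply, Matrix.smul_apply, add_smul, Finset.sum_add_distrib, smul_assoc,
    ← Finset.smul_sum]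
  rw [Block.sum_diagOnes_smul F j j rfl]
  have h1 : (X : ℂ[X]) • F j = c • F j +
      Submodule.Quotient.mk ((X - C c) ^ (e - 1 - (j : ℕ) + 1)) := by
    simp only [F]
    rw [← Submodule.Quotient.mk_smul, ← Submodule.Quotient.mk_smul, ← Submodule.Quotient.mk_add]
    congr 1
    rw [smul_eq_mul, smul_eq_C_mul, pow_succ]
    ring
  rw [h1]
  congr 1
  by_cases hj : (j : ℕ) = 0
  · rw [hzero _ (by omega), Finset.sum_eq_zero]
    intro k _
    rw [Block.superOnes, Matrix.of_apply, if_neg (by omega), zero_smul]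
  · rw [Block.sum_superOnes_smul F j ⟨j - 1, by omega⟩ (by simp only []; omega)]
    simp only [F]
    congr 2
    omega

theorem exists_associated_X_sub_C {p : ℂ[X]} (hp : Irreducible p) :
    ∃ c, Associated (X - C c) p := by
  obtain ⟨c, hc⟩ := IsAlgClosed.exists_root p
    (by rw [IsAlgClosed.degree_eq_one_of_irreducible ℂ hp]; exact one_ne_zero)
  exact ⟨c, (irreducible_X_sub_C c).associated_of_dvd hp (dvd_iff_isRoot.2 hc)⟩

variable {U : Type*} [AddCommGroup U] [Module ℂ U] [FiniteDimensional ℂ U]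

theorem exists_jordan_basis (T : Module.End ℂ U) :
    ∃ (I : Type) (_ : Fintype I) (n : I → ℕ) (c : I → ℂ) (b : Basis (Σ i, Fin (n i + 1)) ℂ U),
      ∀ i j, T (b ⟨i, j⟩)
        = ∑ k, (c i • Block.diagOnes (n i + 1) (n i + 1) +
            Block.superOnes (n i + 1) (n i + 1)) k j • b ⟨i, k⟩ := by
  classical
  obtain ⟨ι, _, p, hp, e, ⟨φ⟩⟩ := Module.equiv_directSum_of_isTorsion
    (Module.AEval.isTorsion_of_finiteDimensional ℂ U T)
  choose c hc using fun i => exists_associated_X_sub_C (hp i)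
  have hspan : ∀ i, Submodule.span ℂ[X] {(X - C (c i)) ^ e i} = Submodule.span ℂ[X] {p i ^ e i} :=
    fun i => Ideal.span_singleton_eq_span_singleton.2 ((hc i).pow_pow)
  have hb : ∀ i, ∃ b : Basis (Fin (e i)) ℂ (ℂ[X] ⧸ Submodule.span ℂ[X] {p i ^ e i}),
      ∀ j, (X : ℂ[X]) • b j
        = ∑ k, (c i • Block.diagOnes (e i) (e i) + Block.superOnes (e i) (e i)) k j • b k := by
    intro i
    rw [← hspan i]
    exact exists_basis_quotient_X_sub_C_pow (c i) (e i)
  choose b hb using hb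
  let D : Basis (Σ i, Fin (e i)) ℂ (DirectSum ι fun i => ℂ[X] ⧸ Submodule.span ℂ[X] {p i ^ e i}) :=
    DFinsupp.basis b
  have hD : ∀ i j, D ⟨i, j⟩ = DirectSum.lof ℂ[X] ι
      (fun i => ℂ[X] ⧸ Submodule.span ℂ[X] {p i ^ e i}) i (b i j) := by
    intro i j
    exact dfinsupp_basis_apply b i j
  let ψ : U ≃ₗ[ℂ] DirectSum ι fun i => ℂ[X] ⧸ Submodule.span ℂ[X] {p i ^ e i} :=
    (AEval'.of T).trans (φ.restrictScalars ℂ)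
  have hψ : ∀ y, T (ψ.symm y) = ψ.symm ((X : ℂ[X]) • y) := by
    intro y
    obtain ⟨x, rfl⟩ := ψ.surjective y
    rw [LinearEquiv.symm_apply_apply, LinearEquiv.eq_symm_apply]
    change φ (AEval'.of T (T x)) = X • φ (AEval'.of T x)
    rw [← AEval'.X_smul_of, map_smul]
  have hTD : ∀ i j, T (ψ.symm (D ⟨i, j⟩)) = ∑ k, (c i • Block.diagOnes (e i) (e i) +
      Block.superOnes (e i) (e i)) k j • ψ.symm (D ⟨i, k⟩) := by
    intro i j
    rw [hψ, hD, ← map_smul, hb, map_sum, map_sum]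
    refine Finset.sum_congr rfl fun k _ => ?_
    rw [LinearMap.map_smul_of_tower, map_smul, hD]
  -- Summands with exponent zero vanish and are discarded, since a Jordan block has positive size.
  choose n hn using fun i : {i // e i ≠ 0} => Nat.exists_eq_succ_of_ne_zero i.2
  let E : (Σ i, Fin (e i)) ≃ Σ i : {i // e i ≠ 0}, Fin (n i + 1) :=
    { toFun := fun q => ⟨⟨q.1, fun h => (Fin.cast h q.2).elim0⟩, Fin.cast (hn ⟨q.1, _⟩) q.2⟩
      invFun := fun q => ⟨q.1.1, Fin.cast (hn q.1).symm q.2⟩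
      left_inv := fun _ => rfl
      right_inv := fun _ => rfl }
  refine ⟨{i // e i ≠ 0}, inferInstance, n, fun i => c i, (D.map ψ.symm).reindex E, fun i j => ?_⟩
  simp only [Basis.reindex_apply, Basis.map_apply]
  refine (hTD i (Fin.cast (hn i).symm j)).trans ?_
  exact ((finCongr (hn i).symm).sum_comp _).symm

end Jordan

/-! ### Pencils containing an invertible map -/

section Regular

variable {U V : Type*} [AddCommGroup U] [Module ℂ U] [FiniteDimensional ℂ U]
  [AddCommGroup V] [Module ℂ V]

theorem isBlockSum_of_bijective_right (A : U →ₗ[ℂ] V) (B : U ≃ₗ[ℂ] V) :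
    IsBlockSum A (B : U →ₗ[ℂ] V) := by
  obtain ⟨I, _, n, c, b, hb⟩ := exists_jordan_basis ((B.symm : V →ₗ[ℂ] U) ∘ₗ A)
  refine ⟨I, ‹_›, fun i => .jordan (n i) (c i), b, b.map B, fun i j => ⟨?_, ?_⟩⟩
  · have h := congrArg B (hb i j)
    rw [LinearMap.comp_apply, LinearEquiv.coe_coe, LinearEquiv.apply_symm_apply, map_sum] at h
    simp only [map_smul] at h
    exact h
  · exact (Block.sum_diagOnes_smul (fun k => b.map B ⟨i, k⟩) j j rfl).symm

/-- The first vector of each Jordan chain of A⁻¹B is an eigenvector, so nilpotence forces eigenvalue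
zero, which gives Jordan blocks at infinity. -/
theorem isBlockSum_of_isNilpotent (A : U ≃ₗ[ℂ] V) (B : U →ₗ[ℂ] V)
    (h : IsNilpotent ((A.symm : V →ₗ[ℂ] U) ∘ₗ B : Module.End ℂ U)) :
    IsBlockSum (A : U →ₗ[ℂ] V) B := by
  obtain ⟨I, _, n, c, b, hb⟩ := exists_jordan_basis ((A.symm : V →ₗ[ℂ] U) ∘ₗ B)
  have hc : ∀ i, c i = 0 := by
    intro i
    have h1 := hb i 0
    simp only [Matrix.add_apply, Matrix.smul_apply, add_smul, Finset.sum_add_distrib, smul_assoc,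
      ← Finset.smul_sum] at h1
    rw [Block.sum_diagOnes_smul (fun k => b ⟨i, k⟩) 0 0 rfl, Finset.sum_eq_zero, add_zero] at h1
    · obtain ⟨m, hm⟩ := h
      have h2 : ∀ m, (((A.symm : V →ₗ[ℂ] U) ∘ₗ B : Module.End ℂ U) ^ m) (b ⟨i, 0⟩)
          = c i ^ m • b ⟨i, 0⟩ := by
        intro m
        induction m with
        | zero => simp
        | succ m ih => rw [pow_succ', Module.End.mul_apply, ih, map_smul, h1, smul_smul, pow_succ]
      have h3 := h2 m
      rw [hm, LinearMap.zero_apply] at h3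
      exact IsNilpotent.eq_zero ⟨m, (smul_eq_zero.1 h3.symm).resolve_right (b.ne_zero _)⟩
    · intro k _
      rw [Block.superOnes, Matrix.of_apply, if_neg (by simp), zero_smul]
  refine ⟨I, ‹_›, fun i => .jordanInfty (n i), b, b.map A, fun i j => ⟨?_, ?_⟩⟩
  · exact (Block.sum_diagOnes_smul (fun k => b.map A ⟨i, k⟩) j j rfl).symm
  · have h := congrArg A (hb i j)
    rw [LinearMap.comp_apply, LinearEquiv.coe_coe, LinearEquiv.apply_symm_apply, map_sum] at h
    simp only [map_smul, hc, zero_smul, zero_add] at h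
    exact h

/-- Fitting decomposition of T: on the nilpotent part 1 − cT is invertible and the blocks are at
infinity, on the other part T is invertible and the blocks have finite eigenvalues. -/
theorem isBlockSum_one_sub_smul (T : Module.End ℂ U) (c : ℂ) : IsBlockSum (1 - c • T) T := by
  obtain ⟨N, hN⟩ := Filter.eventually_atTop.1 T.eventually_isCompl_ker_pow_range_pow
  -- The exponent is made positive so that ker T lies in ker T^m, which gives injectivity of T on
  -- the range part.
  have hcompl := hN (N + 1) (Nat.le_succ N)
  set m := N + 1
  have hT₀ : ∀ u ∈ LinearMap.ker (T ^ m), T u ∈ LinearMap.ker (T ^ m) := fun u hu => by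
    rw [LinearMap.mem_ker, ← Module.End.mul_apply, ← pow_succ, pow_succ', Module.End.mul_apply,
      LinearMap.mem_ker.1 hu, map_zero]
  have hT₁ : ∀ u ∈ LinearMap.range (T ^ m), T u ∈ LinearMap.range (T ^ m) := by
    rintro _ ⟨u, rfl⟩
    exact ⟨T u, by rw [← Module.End.mul_apply, ← Module.End.mul_apply, ← pow_succ, pow_succ']⟩
  have hA₀ : ∀ u ∈ LinearMap.ker (T ^ m), (1 - c • T) u ∈ LinearMap.ker (T ^ m) := fun u hu =>
    Submodule.sub_mem _ hu (Submodule.smul_mem _ _ (hT₀ u hu))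
  have hA₁ : ∀ u ∈ LinearMap.range (T ^ m), (1 - c • T) u ∈ LinearMap.range (T ^ m) := fun u hu =>
    Submodule.sub_mem _ hu (Submodule.smul_mem _ _ (hT₁ u hu))
  refine IsBlockSum.of_isCompl hcompl hcompl hA₀ hT₀ hA₁ hT₁ ?_ ?_
  · have hnil : IsNilpotent (T.restrict hT₀) := by
      refine ⟨m, ?_⟩
      ext u
      rw [Module.End.pow_restrict m]
      exact LinearMap.mem_ker.1 u.2
    have hunit : IsUnit ((1 - c • T).restrict hA₀) := by
      have h1 : (1 - c • T).restrict hA₀ = 1 - c • T.restrict hT₀ := by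
        ext; simp
      rw [h1]
      exact (hnil.smul c).isUnit_one_sub
    obtain ⟨e, he⟩ := hunit
    let E := LinearMap.GeneralLinearGroup.toLinearEquiv e
    have hE : (E : _ →ₗ[ℂ] _) = (1 - c • T).restrict hA₀ := he
    have hE' : (E.symm : _ →ₗ[ℂ] _) = (↑e⁻¹ : Module.End ℂ (LinearMap.ker (T ^ m))) := rfl
    rw [← hE]
    refine isBlockSum_of_isNilpotent E _ ?_
    rw [hE', ← Module.End.mul_eq_comp]
    refine (Commute.isNilpotent_mul_left ?_ hnil)
    refine Commute.units_inv_left ?_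
    rw [he]
    ext u
    simp
  · have hinj : Function.Injective (T.restrict hT₁) := by
      rw [injective_iff_map_eq_zero]
      intro u hu
      have h1 : (u : U) ∈ LinearMap.ker (T ^ m) := by
        have h2 : T (u : U) = 0 := congrArg Subtype.val hu
        have h3 : ∀ v, T v = 0 → (T ^ m) v = 0 := fun v hv => by
          rw [pow_succ, Module.End.mul_apply, hv, map_zero]
        exact h3 _ h2
      exact Subtype.ext (Submodule.disjoint_def.1 hcompl.disjoint _ h1 u.2)
    exact isBlockSum_of_bijective_right _ (LinearEquiv.ofInjectiveEndo (T.restrict hT₁) hinj)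

theorem isBlockSum_of_bijective {A B : U →ₗ[ℂ] V} {c : ℂ}
    (h : Function.Bijective (A + c • B)) : IsBlockSum A B := by
  let E := LinearEquiv.ofBijective (A + c • B) h
  have hE : ∀ u, E u = A u + c • B u := fun u => rfl
  refine (isBlockSum_one_sub_smul ((E.symm : V →ₗ[ℂ] U) ∘ₗ B) c).of_equiv (LinearEquiv.refl ℂ U) E
    (fun u => ?_) (fun u => ?_)
  · rw [LinearMap.sub_apply, LinearMap.smul_apply, map_sub, map_smul, LinearMap.comp_apply,
      LinearEquiv.coe_coe, LinearEquiv.apply_symm_apply, Module.End.one_apply, hE]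
    simp
  · simp

end Regular

/-! ### Existence of the Kronecker canonical form -/

section Existence

-- The determinant of A + XB vanishes at every c, hence identically, so some non-zero row vector
-- over ℂ[X] kills the pencil; φ i is its coefficient of X^i.
open Polynomial in
theorem exists_left_kernel {U V : Type*} [AddCommGroup U] [Module ℂ U] [FiniteDimensional ℂ U]
    [AddCommGroup V] [Module ℂ V] [FiniteDimensional ℂ V] (A B : U →ₗ[ℂ] V)
    (hdim : finrank ℂ U = finrank ℂ V) (h : ∀ c : ℂ, ¬ Function.Bijective (A + c • B)) :
    ∃ (φ : ℕ → Dual ℂ V) (N : ℕ), (∃ i, φ i ≠ 0) ∧ (∀ i, N ≤ i → φ i = 0) ∧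
      φ 0 ∘ₗ A = 0 ∧ ∀ i, φ (i + 1) ∘ₗ A + φ i ∘ₗ B = 0 := by
  let bU : Basis (Fin (finrank ℂ V)) ℂ U := finBasisOfFinrankEq ℂ U hdim
  let bV : Basis (Fin (finrank ℂ V)) ℂ V := finBasis ℂ V
  let MA := LinearMap.toMatrix bU bV A
  let MB := LinearMap.toMatrix bU bV B
  let P : Matrix (Fin (finrank ℂ V)) (Fin (finrank ℂ V)) ℂ[X] :=
    MA.map C + (X : ℂ[X]) • MB.map C
  have hdet : P.det = 0 := by
    refine Polynomial.funext fun c => ?_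
    rw [eval_zero, ← coe_evalRingHom, RingHom.map_det]
    have h1 : (evalRingHom c).mapMatrix P = LinearMap.toMatrix bU bV (A + c • B) := by
      ext i j
      simp only [P, MA, MB, RingHom.mapMatrix_apply, Matrix.map_apply, Matrix.add_apply,
        Matrix.smul_apply, smul_eq_mul, coe_evalRingHom, eval_mul, eval_X, eval_C,
        map_add, map_smul]
    rw [h1]
    by_contra hne
    have hu : IsUnit (LinearMap.toMatrix bU bV (A + c • B)).det := isUnit_iff_ne_zero.2 hne
    exact h c (LinearEquiv.ofIsUnitDet hu).bijective
  obtain ⟨w, hw0, hw⟩ := Matrix.exists_vecMul_eq_zero_iff.2 hdet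
  let φ : ℕ → Dual ℂ V := fun i => ∑ k, (w k).coeff i • bV.coord k
  have hφ : ∀ (i : ℕ) (T : U →ₗ[ℂ] V) j, (φ i ∘ₗ T) (bU j)
      = ∑ k, (w k).coeff i * LinearMap.toMatrix bU bV T k j := by
    intro i T j
    simp [φ, LinearMap.toMatrix_apply]
  have hrel : ∀ j, ∑ k, w k * (C (MA k j) + X * C (MB k j)) = 0 := by
    intro j
    have h1 := congrFun hw j
    simpa [Matrix.vecMul, dotProduct, P] using h1
  refine ⟨φ, (Finset.univ.sup fun k => (w k).natDegree) + 1, ?_, ?_, ?_, ?_⟩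
  · obtain ⟨k, hk⟩ := Function.ne_iff.1 hw0
    obtain ⟨i, hi⟩ := not_forall.1 (fun h => hk (Polynomial.ext h))
    refine ⟨i, fun h => hi ?_⟩
    have h1 := LinearMap.congr_fun h (bV k)
    simpa [φ, LinearMap.sum_apply, Finsupp.single_apply] using h1
  · intro i hi
    refine Finset.sum_eq_zero fun k _ => ?_
    rw [coeff_eq_zero_of_natDegree_lt, zero_smul]
    exact lt_of_le_of_lt (Finset.le_sup (f := fun k => (w k).natDegree) (Finset.mem_univ k)) hi
  · refine bU.ext fun j => ?_
    have h1 := congrArg (fun p => coeff p 0) (hrel j)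
    rw [hφ]
    simpa [mul_add, finsetSum_coeff] using h1
  · intro i
    refine bU.ext fun j => ?_
    rw [LinearMap.add_apply, hφ, hφ, ← Finset.sum_add_distrib]
    have h2 : ∀ k, w k * (C (MA k j) + X * C (MB k j))
        = w k * C (MA k j) + w k * C (MB k j) * X := fun k => by ring
    have h1 := hrel j
    simp only [h2] at h1
    have h3 := congrArg (fun p => coeff p (i + 1)) h1
    simpa [finsetSum_coeff] using h3

theorem isBlockSum_of_range_ne_top {U V : Type*} [AddCommGroup U] [Module ℂ U]
    [AddCommGroup V] [Module ℂ V] [FiniteDimensional ℂ V] {A B : U →ₗ[ℂ] V}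
    {W : Submodule ℂ V} (hA : ∀ u ∈ (⊤ : Submodule ℂ U), A u ∈ W)
    (hB : ∀ u ∈ (⊤ : Submodule ℂ U), B u ∈ W)
    (h : IsBlockSum (A.restrict hA) (B.restrict hB)) : IsBlockSum A B := by
  obtain ⟨W', hW'⟩ := W.exists_isCompl
  refine IsBlockSum.of_isCompl (isCompl_top_bot (α := Submodule ℂ U)) hW' hA hB
    (fun u hu => ?_) (fun u hu => ?_) h (isBlockSum_of_subsingleton _ _) <;>
  · rw [(Submodule.mem_bot ℂ).1 hu, map_zero]
    exact W'.zero_mem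

/-- Every pencil of linear maps between finite-dimensional spaces is a direct sum of blocks. -/
theorem isBlockSum_of_finrank_add_eq (d : ℕ) : ∀ (U V : Type) [AddCommGroup U] [Module ℂ U]
    [FiniteDimensional ℂ U] [AddCommGroup V] [Module ℂ V] [FiniteDimensional ℂ V]
    (A B : U →ₗ[ℂ] V), finrank ℂ U + finrank ℂ V = d → IsBlockSum A B := by
  induction d using Nat.strong_induction_on with
  | _ d ih =>
  have hrange : ∀ (U V : Type) [AddCommGroup U] [Module ℂ U]
      [FiniteDimensional ℂ U] [AddCommGroup V] [Module ℂ V] [FiniteDimensional ℂ V]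
      (A B : U →ₗ[ℂ] V), finrank ℂ U + finrank ℂ V = d →
      LinearMap.range A ⊔ LinearMap.range B ≠ ⊤ → IsBlockSum A B := by
    intro U V _ _ _ _ _ _ A B hd hne
    have h1 := Submodule.finrank_lt hne
    refine isBlockSum_of_range_ne_top (W := LinearMap.range A ⊔ LinearMap.range B)
      (fun u _ => Submodule.mem_sup_left ⟨u, rfl⟩) (fun u _ => Submodule.mem_sup_right ⟨u, rfl⟩) ?_
    exact ih _ (by rw [← hd, finrank_top]; omega) _ _ _ _ rfl
  -- When dim U < dim V, reflection lowers the total dimension, since the new source has dimension 2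
  -- dim U − dim V.
  have hlt : ∀ (U V : Type) [AddCommGroup U] [Module ℂ U]
      [FiniteDimensional ℂ U] [AddCommGroup V] [Module ℂ V] [FiniteDimensional ℂ V]
      (A B : U →ₗ[ℂ] V), finrank ℂ U + finrank ℂ V = d → finrank ℂ U < finrank ℂ V →
      IsBlockSum A B := by
    intro U V _ _ _ _ _ _ A B hd hUV
    by_cases hAB : LinearMap.range A ⊔ LinearMap.range B = ⊤
    · have h1 := finrank_reflectSpace hAB
      exact isBlockSum_of_reflect hAB (ih _ (by omega) _ _ _ _ rfl)
    · exact hrange U V A B hd hAB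
  -- When dim U = dim V, reflection preserves both dimensions, so the induction is on the length N
  -- of a polynomial left kernel vector: composing its coefficients with B gives a shorter one for
  -- the reflected pencil.
  have heq : ∀ (N : ℕ) (U V : Type) [AddCommGroup U] [Module ℂ U]
      [FiniteDimensional ℂ U] [AddCommGroup V] [Module ℂ V] [FiniteDimensional ℂ V]
      (A B : U →ₗ[ℂ] V) (φ : ℕ → Dual ℂ V), finrank ℂ U + finrank ℂ V = d →
      finrank ℂ U = finrank ℂ V → (∃ i, φ i ≠ 0) → (∀ i, N ≤ i → φ i = 0) →
      φ 0 ∘ₗ A = 0 → (∀ i, φ (i + 1) ∘ₗ A + φ i ∘ₗ B = 0) → IsBlockSum A B := by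
    intro N
    induction N with
    | zero =>
      rintro U V _ _ _ _ _ _ A B φ - - ⟨i, hi⟩ h0 - -
      exact absurd (h0 i (Nat.zero_le i)) hi
    | succ N ihN =>
      rintro U V _ _ _ _ _ _ A B φ hd hUV ⟨i, hi⟩ hN h0 hrel
      by_cases hAB : LinearMap.range A ⊔ LinearMap.range B = ⊤
      · have h1 := finrank_reflectSpace hAB
        refine isBlockSum_of_reflect hAB (ihN _ _ _ _ (fun i => φ i ∘ₗ B) (by omega) (by omega)
          ?_ ?_ ?_ ?_)
        -- If every φ i ∘ B vanished, then so would every φ i ∘ A, and φ i would vanish on im A + im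
        -- B = V.
        · by_contra! hB
          have hA : ∀ i, φ i ∘ₗ A = 0 := by
            rintro (_ | i)
            · exact h0
            · have := hrel i
              rwa [hB, add_zero] at this
          refine hi (LinearMap.ker_eq_top.1 (top_le_iff.1 ?_))
          rw [← hAB, sup_le_iff]
          exact ⟨LinearMap.range_le_ker_iff.2 (hA i), LinearMap.range_le_ker_iff.2 (hB i)⟩
        · intro i hi
          have := hrel i
          rwa [hN (i + 1) (by omega), LinearMap.zero_comp, zero_add] at this
        · ext w
          have := LinearMap.congr_fun h0 (reflectB A B w)
          rwa [LinearMap.comp_apply, apply_reflectB] at this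
        · intro i
          ext w
          have := LinearMap.congr_fun (hrel i) (reflectB A B w)
          rwa [LinearMap.add_apply, LinearMap.comp_apply, apply_reflectB] at this
      · exact hrange U V A B hd hAB
  intro U V _ _ _ _ _ _ A B hd
  rcases lt_trichotomy (finrank ℂ U) (finrank ℂ V) with h | h | h
  · exact hlt U V A B hd h
  · by_cases hreg : ∃ c : ℂ, Function.Bijective (A + c • B)
    · obtain ⟨c, hc⟩ := hreg
      exact isBlockSum_of_bijective hc
    · obtain ⟨φ, N, hne, hN, h0, hrel⟩ := exists_left_kernel A B h (not_exists.1 hreg)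
      exact heq N U V A B φ hd h hne hN h0 hrel
  · refine isBlockSum_of_dualMap (hlt _ _ _ _ ?_ ?_)
    · rw [Subspace.dual_finrank_eq, Subspace.dual_finrank_eq]; omega
    · rwa [Subspace.dual_finrank_eq, Subspace.dual_finrank_eq]

theorem exists_hasCanonicalForm {U V : Type*} [AddCommGroup U] [Module ℂ U]
    [FiniteDimensional ℂ U] [AddCommGroup V] [Module ℂ V] [FiniteDimensional ℂ V]
    (A B : U →ₗ[ℂ] V) : ∃ (N : ℕ) (bs : Fin N → Block), HasCanonicalForm A B bs := by
  let eU := (finBasis ℂ U).equivFun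
  let eV := (finBasis ℂ V).equivFun
  refine IsBlockSum.exists_hasCanonicalForm ?_
  refine (isBlockSum_of_finrank_add_eq _ _ _ ((eV : V →ₗ[ℂ] _) ∘ₗ A ∘ₗ (eU.symm : _ →ₗ[ℂ] U))
    ((eV : V →ₗ[ℂ] _) ∘ₗ B ∘ₗ (eU.symm : _ →ₗ[ℂ] U)) rfl).of_equiv eU.symm eV.symm
    (fun u => ?_) (fun u => ?_) <;> simp

end Existence

/-! ### The left kernel of a pencil in canonical form -/

namespace Block

/-- Forward substitution along the columns. The condition m ≤ n covers square and horizontal blocks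
at once. -/
theorem eq_zero_of_bidiagonal {m n : ℕ} (hmn : m ≤ n) {a : ℂ} (ha : a ≠ 0) (c : ℂ) {y : Fin m → ℂ}
    (hy : ∀ j, a * ∑ k, diagOnes m n k j • y k + c * ∑ k, superOnes m n k j • y k = 0) :
    y = 0 := by
  have key : ∀ (l : ℕ) (hl : l < m), y ⟨l, hl⟩ = 0 := by
    intro l
    induction l with
    | zero =>
      intro hl
      have h1 := hy ⟨0, hl.trans_le hmn⟩
      rw [(sum_diagOnes_smul y ⟨0, hl.trans_le hmn⟩ ⟨0, hl⟩ rfl),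
        Finset.sum_eq_zero (s := Finset.univ) (f := fun k => superOnes m n k _ • y k), mul_zero,
        add_zero] at h1
      · exact (mul_eq_zero.1 h1).resolve_left ha
      · intro k _
        rw [superOnes, Matrix.of_apply, if_neg (Nat.succ_ne_zero _).symm, zero_smul]
    | succ l ih =>
      intro hl
      have h1 := hy ⟨l + 1, hl.trans_le hmn⟩
      rw [(sum_diagOnes_smul y ⟨l + 1, hl.trans_le hmn⟩ ⟨l + 1, hl⟩ rfl),
        (sum_superOnes_smul y ⟨l + 1, hl.trans_le hmn⟩ ⟨l, (Nat.lt_succ_self l).trans hl⟩ rfl),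
        ih, mul_zero, add_zero] at h1
      exact (mul_eq_zero.1 h1).resolve_left ha
  exact funext fun k => key k k.2

theorem eq_zero_of_left_kernel (b : Block) (hb : b.verticalRows = 0) :
    ∃ F : Finset ℂ, ∀ c ∉ F, ∀ y : Fin b.rows → ℂ,
      (∀ j, ∑ k, b.matA k j * y k + c * ∑ k, b.matB k j * y k = 0) → y = 0 := by
  cases b with
  | vertical η => simp [verticalRows] at hb
  | jordan n a =>
    refine ⟨{-a}, fun c hc (y : Fin (n + 1) → ℂ) hy => ?_⟩
    have hac : a + c ≠ 0 := fun h => hc (by rw [Finset.mem_singleton]; linear_combination h)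
    refine eq_zero_of_bidiagonal (n := n + 1) le_rfl hac 1 fun j => ?_
    have h1 : ∑ k : Fin (n + 1), (a • diagOnes (n + 1) (n + 1) + superOnes (n + 1) (n + 1)) k j * y k
      + c * ∑ k : Fin (n + 1), diagOnes (n + 1) (n + 1) k j * y k = 0 := hy j
    simp only [Matrix.add_apply, Matrix.smul_apply, smul_eq_mul, add_mul, mul_assoc,
      Finset.sum_add_distrib, ← Finset.mul_sum] at h1
    simp only [smul_eq_mul]
    linear_combination h1
  | jordanInfty n =>
    refine ⟨∅, fun c _ (y : Fin (n + 1) → ℂ) hy => ?_⟩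
    refine eq_zero_of_bidiagonal (n := n + 1) le_rfl one_ne_zero c fun j => ?_
    rw [one_mul]
    exact hy j
  | horizontal ε =>
    refine ⟨∅, fun c _ (y : Fin ε → ℂ) hy => ?_⟩
    refine eq_zero_of_bidiagonal (n := ε + 1) (Nat.le_succ ε) one_ne_zero c fun j => ?_
    rw [one_mul]
    exact hy j

/-- The equations read y_j = −c y_{j+1}, so the left kernel is a line, traced by a curve of degree η
in c normalised by its last entry. -/
theorem left_kernel_vertical_iff (η : ℕ) (c : ℂ) (y : Fin (η + 1) → ℂ) :
    (∀ j, ∑ k, (vertical η).matA k j * y k + c * ∑ k, (vertical η).matB k j * y k = 0) ↔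
      ∀ k, y k = (-c) ^ (Fin.rev k : ℕ) * y (Fin.last η) := by
  have hrel : ∀ j : Fin η, ∑ k, (vertical η).matA k j * y k + c * ∑ k, (vertical η).matB k j * y k
      = y j.castSucc + c * y j.succ := fun j => by
    refine congrArg₂ (fun s t => s + c * t) ?_ ?_
    · exact sum_diagOnes_smul (m := η + 1) (n := η) y j j.castSucc rfl
    · exact sum_subOnes_smul (m := η + 1) (n := η) y j j.succ rfl
  constructor
  · intro h k
    refine Fin.reverseInduction ?_ (fun j ih => ?_) k
    · simp
    · have h1 := (hrel j).symm.trans (h j)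
      have h2 : (Fin.rev j.castSucc : ℕ) = (Fin.rev j.succ : ℕ) + 1 := by
        simp only [Fin.val_rev, Fin.val_castSucc, Fin.val_succ]; omega
      rw [h2, pow_succ]
      rw [ih] at h1
      linear_combination h1
  · intro h (j : Fin η)
    have h2 : (Fin.rev j.castSucc : ℕ) = (Fin.rev j.succ : ℕ) + 1 := by
      simp only [Fin.val_rev, Fin.val_castSucc, Fin.val_succ]; omega
    refine (hrel j).trans ?_
    rw [h j.castSucc, h j.succ, h2, pow_succ]
    ring

theorem left_kernel_iff (b : Block) (hb : b.verticalRows ≠ 0) :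
    b.rows = b.verticalRows ∧ ∃ l : Fin b.rows, (l.rev : ℕ) = 0 ∧ ∀ (c : ℂ) (y : Fin b.rows → ℂ),
      (∀ j, ∑ k, b.matA k j * y k + c * ∑ k, b.matB k j * y k = 0) ↔
        ∀ k, y k = (-c) ^ (Fin.rev k : ℕ) * y l := by
  cases b with
  | vertical η =>
    exact ⟨rfl, Fin.last η, by simp [rows], left_kernel_vertical_iff η⟩
  | jordan n a => exact absurd rfl hb
  | jordanInfty n => exact absurd rfl hb
  | horizontal ε => exact absurd rfl hb

end Block

section LeftKernel

variable {U V : Type*} [AddCommGroup U] [Module ℂ U] [AddCommGroup V] [Module ℂ V]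

theorem dualMap_eq_zero_iff {A B : U →ₗ[ℂ] V} {I : Type} [Fintype I] {bs : I → Block}
    {bU : Basis (Σ i, Fin (bs i).cols) ℂ U} {bV : Basis (Σ i, Fin (bs i).rows) ℂ V}
    (h : IsBlockBasis A B bs bU bV) (c : ℂ) (φ : Dual ℂ V) :
    (A + c • B).dualMap φ = 0 ↔ ∀ i j, ∑ k, (bs i).matA k j * φ (bV ⟨i, k⟩)
      + c * ∑ k, (bs i).matB k j * φ (bV ⟨i, k⟩) = 0 := by
  have key : ∀ i j, (A + c • B).dualMap φ (bU ⟨i, j⟩) = ∑ k, (bs i).matA k j * φ (bV ⟨i, k⟩)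
      + c * ∑ k, (bs i).matB k j * φ (bV ⟨i, k⟩) := by
    intro i j
    rw [LinearMap.dualMap_apply, LinearMap.add_apply, LinearMap.smul_apply, (h i j).1, (h i j).2]
    simp only [map_add, map_smul, map_sum, smul_eq_mul]
  constructor
  · intro h0 i j
    rw [← key, h0, LinearMap.zero_apply]
  · intro h0
    refine bU.ext ?_
    rintro ⟨i, j⟩
    rw [key, h0, LinearMap.zero_apply]

/-- A minimal polynomial basis of the left kernel of the pencil `A + t B`. -/
theorem exists_minimal_left_kernel_basis [FiniteDimensional ℂ U] [FiniteDimensional ℂ V]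
    (A B : U →ₗ[ℂ] V) :
    ∃ (J : Type) (_ : Fintype J) (d : J → ℕ) (w : (Σ j, Fin (d j)) → Dual ℂ V) (F : Finset ℂ),
      (∀ j, 0 < d j) ∧ LinearIndependent ℂ w ∧ pencilKVert A B = ∑ j, d j ∧
      (∀ (c : ℂ) j, (A + c • B).dualMap (∑ m : Fin (d j), c ^ (m : ℕ) • w ⟨j, m⟩) = 0) ∧
      ∀ c ∉ F, ∀ φ, (A + c • B).dualMap φ = 0 →
        φ ∈ Submodule.span ℂ (Set.range fun j => ∑ m : Fin (d j), c ^ (m : ℕ) • w ⟨j, m⟩) := by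
  classical
  have hne : {k | ∃ (N : ℕ) (bs : Fin N → Block),
    HasCanonicalForm A B bs ∧ k = ∑ i, (bs i).verticalRows}.Nonempty := by
    obtain ⟨N, bs, h⟩ := exists_hasCanonicalForm A B
    exact ⟨_, N, bs, h, rfl⟩
  -- The infimum defining `pencilKVert` is attained because a canonical form exists, so uniqueness
  -- of the form is never needed.
  obtain ⟨N, bs, hcf, hk⟩ := Nat.sInf_mem hne
  obtain ⟨bU, bV, hb⟩ := (hasCanonicalForm_iff _ _ _).1 hcf
  have hF : ∀ i, ∃ F : Finset ℂ, (bs i).verticalRows = 0 → ∀ c ∉ F, ∀ y : Fin (bs i).rows → ℂ,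
      (∀ j, ∑ k, (bs i).matA k j * y k + c * ∑ k, (bs i).matB k j * y k = 0) → y = 0 := by
    intro i
    by_cases hi : (bs i).verticalRows = 0
    · obtain ⟨F, hF⟩ := (bs i).eq_zero_of_left_kernel hi
      exact ⟨F, fun _ => hF⟩
    · exact ⟨∅, fun h => absurd h hi⟩
  choose F hF using hF
  choose hrows l hl hker using fun i : {i // (bs i).verticalRows ≠ 0} =>
    (bs i).left_kernel_iff i.2
  -- The coefficient of c^m in the kernel curve of a vertical block: the sign comes from (−c)^m, the
  -- reversal from normalising the last entry.
  let w : (Σ j : {i // (bs i).verticalRows ≠ 0}, Fin (bs j).rows) → Dual ℂ V :=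
    fun p => (-1 : ℂ) ^ (p.2 : ℕ) • bV.coord ⟨p.1, p.2.rev⟩
  have hψ : ∀ (c : ℂ) (j : {i // (bs i).verticalRows ≠ 0}) (q : Σ i, Fin (bs i).rows),
      (∑ m : Fin (bs j).rows, c ^ (m : ℕ) • w ⟨j, m⟩ : Dual ℂ V) (bV q)
        = if j.1 = q.1 then (-c) ^ (q.2.rev : ℕ) else 0 := by
    rintro c j ⟨i, k⟩
    rw [LinearMap.sum_apply]
    simp only [w, LinearMap.smul_apply, Basis.coord_apply, Basis.repr_self, smul_smul,
      smul_eq_mul, ← mul_pow, mul_neg_one]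
    split_ifs with hij
    · subst hij
      rw [Finset.sum_eq_single k.rev]
      · simp
      · intro m _ hm
        rw [Finsupp.single_eq_of_ne, mul_zero]
        intro h
        simp only [Sigma.mk.injEq, heq_eq_eq, true_and] at h
        exact hm (by rw [← h, Fin.rev_rev])
      · simp
    · refine Finset.sum_eq_zero fun m _ => ?_
      rw [Finsupp.single_eq_of_ne, mul_zero]
      intro h
      exact hij (congrArg Sigma.fst h)
  refine ⟨{i // (bs i).verticalRows ≠ 0}, inferInstance, fun j => (bs j).rows, w,
    Finset.univ.biUnion F, fun j => ?_, ?_, ?_, ?_, ?_⟩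
  · simp only [hrows]
    exact Nat.pos_of_ne_zero j.2
  · let E : (Σ j : {i // (bs i).verticalRows ≠ 0}, Fin (bs j).rows) → Σ i, Fin (bs i).rows :=
      fun p => ⟨p.1, p.2.rev⟩
    have hE : Function.Injective E := by
      rintro ⟨⟨i, hi⟩, k⟩ ⟨⟨i', hi'⟩, k'⟩ h
      obtain ⟨rfl, h2⟩ := Sigma.mk.inj_iff.1 h
      rw [heq_eq_eq, Fin.rev_inj] at h2
      subst h2
      rfl
    have h1 : LinearIndependent ℂ fun p => bV.coord (E p) := by
      have h2 := bV.dualBasis.linearIndependent.comp E hE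
      rwa [Basis.coe_dualBasis] at h2
    exact h1.units_smul fun p => (-1 : ℂˣ) ^ (p.2 : ℕ)
  · rw [pencilKVert, hk, ← Finset.sum_filter_ne_zero, Finset.sum_congr rfl fun j _ => hrows j]
    exact Finset.sum_subtype _ (by simp) _
  · intro c j
    rw [dualMap_eq_zero_iff hb]
    intro i k
    simp only [hψ]
    by_cases hij : j.1 = i
    · subst hij
      simp only [if_true]
      revert k
      rw [hker j]
      intro k
      rw [hl j, pow_zero, mul_one]
    · simp [hij]
  · intro c hc φ hφ
    rw [dualMap_eq_zero_iff hb] at hφ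
    have hφ' : φ = ∑ j : {i // (bs i).verticalRows ≠ 0}, φ (bV ⟨j, l j⟩) •
        ∑ m : Fin (bs j).rows, c ^ (m : ℕ) • w ⟨j, m⟩ := by
      refine bV.ext ?_
      rintro ⟨i, k⟩
      rw [LinearMap.sum_apply]
      simp only [LinearMap.smul_apply, hψ, smul_eq_mul]
      by_cases hi : (bs i).verticalRows = 0
      · rw [Finset.sum_eq_zero]
        · have h1 := hF i hi c (fun h => hc (Finset.mem_biUnion.2 ⟨i, Finset.mem_univ i, h⟩)) _
            (hφ i)
          exact congrFun h1 k
        · intro j _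
          rw [if_neg (fun h : j.1 = i => j.2 (h ▸ hi)), mul_zero]
      · rw [Finset.sum_eq_single ⟨i, hi⟩]
        · rw [if_pos rfl, mul_comm]
          exact (hker ⟨i, hi⟩ c _).1 (hφ i) k
        · intro j _ hj
          rw [if_neg (fun h => hj (Subtype.ext h)), mul_zero]
        · simp
    rw [hφ']
    exact Submodule.sum_mem _ fun j _ => Submodule.smul_mem _ _ (Submodule.subset_span ⟨j, rfl⟩)

end LeftKernel

/-! ### Differentials and transcendence degree -/

section Jacobian

open MvPolynomial

variable {κ : Type*}

/-- The gradient of a polynomial at a point. -/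
def grad (f : MvPolynomial κ ℂ) (x : κ → ℂ) : κ → ℂ := fun k => eval x (pderiv k f)

theorem grad_add (f g : MvPolynomial κ ℂ) (x : κ → ℂ) :
    grad (f + g) x = grad f x + grad g x := by
  ext k; simp [grad]

theorem grad_mul (f g : MvPolynomial κ ℂ) (x : κ → ℂ) :
    grad (f * g) x = eval x f • grad g x + eval x g • grad f x := by
  ext k; simp [grad, Derivation.leibniz]

theorem grad_pow (f : MvPolynomial κ ℂ) (n : ℕ) (x : κ → ℂ) :
    grad (f ^ n) x = eval x ((n : MvPolynomial κ ℂ) * f ^ (n - 1)) • grad f x := by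
  ext k; simp [grad, Derivation.leibniz_pow, mul_assoc]

theorem grad_C (c : ℂ) (x : κ → ℂ) : grad (C c) x = 0 := by
  ext k; simp [grad]

theorem grad_X [DecidableEq κ] (k : κ) (x : κ → ℂ) : grad (X k) x = Pi.single k 1 := by
  ext j
  simp [grad, pderiv_X, Pi.single_apply, eq_comm]

theorem grad_mem_span_of_mem_adjoin {s : Set (MvPolynomial κ ℂ)} {f : MvPolynomial κ ℂ}
    (hf : f ∈ Algebra.adjoin ℂ s) (x : κ → ℂ) :
    grad f x ∈ Submodule.span ℂ ((fun g => grad g x) '' s) := by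
  induction hf using Algebra.adjoin_induction with
  | mem g hg => exact Submodule.subset_span ⟨g, hg, rfl⟩
  | algebraMap c => rw [algebraMap_eq, grad_C]; exact Submodule.zero_mem _
  | add f g _ _ hf hg => rw [grad_add]; exact Submodule.add_mem _ hf hg
  | mul f g _ _ hf hg =>
    rw [grad_mul]
    exact Submodule.add_mem _ (Submodule.smul_mem _ _ hg) (Submodule.smul_mem _ _ hf)

/-- Chain rule: for p = Σ c_i X^i, the differential of p(f) is p'(f) df plus a combination of the
dc_i. -/
theorem grad_aeval_sub_mem {S : Subalgebra ℂ (MvPolynomial κ ℂ)} (p : Polynomial S)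
    (f : MvPolynomial κ ℂ) (x : κ → ℂ) :
    grad (Polynomial.aeval f p) x - eval x (Polynomial.aeval f p.derivative) • grad f x ∈
      Submodule.span ℂ ((fun g => grad g x) '' (S : Set (MvPolynomial κ ℂ))) := by
  induction p using Polynomial.induction_on' with
  | add p q hp hq =>
    rw [map_add, map_add, map_add, grad_add, map_add, add_smul, add_sub_add_comm]
    exact Submodule.add_mem _ hp hq
  | monomial n c =>
    rw [Polynomial.derivative_monomial, Polynomial.aeval_monomial, Polynomial.aeval_monomial,
      grad_mul, grad_pow, smul_smul]
    have h1 : eval x (algebraMap S (MvPolynomial κ ℂ) c) *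
        eval x ((n : MvPolynomial κ ℂ) * f ^ (n - 1))
        = eval x (algebraMap S (MvPolynomial κ ℂ) (c * n) * f ^ (n - 1)) := by
      simp only [map_mul, map_natCast]
      ring
    rw [h1, add_sub_cancel_left]
    exact Submodule.smul_mem _ _ (Submodule.subset_span ⟨_, c.2, rfl⟩)

/-- Take p of least degree with p(f) = 0. Then p'(f) ≠ 0 by minimality, and wherever it does not
vanish, differentiating p(f) = 0 expresses df through differentials of S. -/
theorem exists_grad_mem_span_of_isAlgebraic {S : Subalgebra ℂ (MvPolynomial κ ℂ)}
    {f : MvPolynomial κ ℂ} (hf : IsAlgebraic S f) :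
    ∃ q : MvPolynomial κ ℂ, q ≠ 0 ∧ ∀ x, eval x q ≠ 0 →
      grad f x ∈ Submodule.span ℂ ((fun g => grad g x) '' (S : Set (MvPolynomial κ ℂ))) := by
  classical
  have hex : ∃ n, ∃ p : Polynomial S, p ≠ 0 ∧ Polynomial.aeval f p = 0 ∧ p.natDegree = n := by
    obtain ⟨p, hp, h0⟩ := hf
    exact ⟨_, p, hp, h0, rfl⟩
  obtain ⟨p, hp, h0, hn⟩ := Nat.find_spec hex
  have hpos : 0 < p.natDegree := by
    rw [Nat.pos_iff_ne_zero]
    intro hz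
    obtain ⟨c, hc⟩ := Polynomial.natDegree_eq_zero.1 hz
    rw [← hc, Polynomial.aeval_C] at h0
    exact hp (by rw [← hc, Subtype.ext (a1 := c) (a2 := 0) h0, map_zero])
  refine ⟨Polynomial.aeval f p.derivative, fun h => ?_, fun x hx => ?_⟩
  · have hlt := Polynomial.natDegree_derivative_lt hpos.ne'
    refine Nat.find_min hex (hn ▸ hlt) ⟨p.derivative, fun hz => ?_, h, rfl⟩
    have h2 := Polynomial.derivative_eq_zero.1 hz
    omega
  · have h1 := grad_aeval_sub_mem p f x
    have h2 : grad (0 : MvPolynomial κ ℂ) x = 0 := by rw [← map_zero C, grad_C]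
    rw [h0, h2, zero_sub, Submodule.neg_mem_iff] at h1
    exact (Submodule.smul_mem_iff _ hx).1 h1

/-- Linear independence of polynomial vectors is an open condition. -/
theorem exists_eval_ne_zero_of_linearIndependent {σ κ J : Type*} [Fintype κ] [Fintype J]
    (p : J → κ → MvPolynomial σ ℂ) (x₀ : σ → ℂ)
    (h : LinearIndependent ℂ fun j k => eval x₀ (p j k)) :
    ∃ q : MvPolynomial σ ℂ, eval x₀ q ≠ 0 ∧ ∀ x, eval x q ≠ 0 →
      LinearIndependent ℂ fun j k => eval x (p j k) := by
  classical
  -- Composing with a left inverse chosen at x₀ gives a square matrix of polynomials that is the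
  -- identity at x₀; its determinant is the required q.
  obtain ⟨g₀, hg₀⟩ := LinearMap.exists_leftInverse_of_injective _ (LinearMap.ker_eq_bot.2 h)
  let g : (κ → ℂ) →ₗ[ℂ] (J → ℂ) := (Finsupp.linearEquivFunOnFinite ℂ ℂ J : _ →ₗ[ℂ] _) ∘ₗ g₀
  have hg' : ∀ j, g (fun k => eval x₀ (p j k)) = Pi.single j 1 := by
    intro j
    have h1 := LinearMap.congr_fun hg₀ (Finsupp.single j 1)
    rw [LinearMap.comp_apply, Finsupp.linearCombination_single, one_smul] at h1
    simp only [g, LinearMap.comp_apply, h1]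
    simp
  let G := LinearMap.toMatrix' g
  let M : Matrix J J (MvPolynomial σ ℂ) := Matrix.of fun j i => ∑ k, C (G i k) * p j k
  have hM : ∀ x, (eval x).mapMatrix M = Matrix.of fun j => g fun k => eval x (p j k) := by
    intro x
    ext j i
    have h1 : g = Matrix.toLin' G := (Matrix.toLin'_toMatrix' g).symm
    rw [h1]
    simp [M, Matrix.mulVec, dotProduct]
  refine ⟨M.det, ?_, fun x hx => ?_⟩
  · rw [RingHom.map_det, hM]
    have h1 : (Matrix.of fun j => g fun k => eval x₀ (p j k)) = 1 := by
      ext j i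
      rw [Matrix.of_apply, hg', Matrix.one_apply, Pi.single_apply]
      exact if_congr eq_comm rfl rfl
    rw [h1, Matrix.det_one]
    exact one_ne_zero
  · rw [RingHom.map_det, hM] at hx
    have h1 := Matrix.linearIndependent_rows_of_det_ne_zero hx
    exact LinearIndependent.of_comp g h1

theorem exists_eval_ne_zero {σ : Type*} {q : MvPolynomial σ ℂ} (hq : q ≠ 0) :
    ∃ x, eval x q ≠ 0 := by
  by_contra! h
  exact hq (MvPolynomial.funext fun x => by rw [h x, map_zero])

variable [Fintype κ]

/-- Independence at x₀ spreads to generic points, where an algebraic dependence would put one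
differential in the span of the others. -/
theorem algebraicIndependent_of_linearIndependent_grad {J : Type*} [Fintype J]
    (f : J → MvPolynomial κ ℂ) (x₀ : κ → ℂ) (h : LinearIndependent ℂ fun j => grad (f j) x₀) :
    AlgebraicIndependent ℂ f := by
  obtain ⟨q, hq, hq'⟩ := exists_eval_ne_zero_of_linearIndependent
    (fun j k => pderiv k (f j)) x₀ h
  refine algebraicIndependent_of_finite_type' (C_injective _ _) fun t _ _ i hi halg => ?_
  obtain ⟨q₁, hq₁, h₁⟩ := exists_grad_mem_span_of_isAlgebraic halg
  obtain ⟨x, hx⟩ := exists_eval_ne_zero (mul_ne_zero (ne_of_apply_ne (eval x₀) (by simpa using hq))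
    hq₁ : q * q₁ ≠ 0)
  rw [map_mul] at hx
  have h2 := h₁ x (right_ne_zero_of_mul hx)
  have h3 : Submodule.span ℂ ((fun g => grad g x) ''
      (Algebra.adjoin ℂ (f '' t) : Set (MvPolynomial κ ℂ))) ≤
      Submodule.span ℂ ((fun j => grad (f j) x) '' t) := by
    rw [Submodule.span_le]
    rintro _ ⟨g, hg, rfl⟩
    have h4 := grad_mem_span_of_mem_adjoin hg x
    rwa [Set.image_image] at h4
  have h4 : LinearIndependent ℂ fun j => grad (f j) x := hq' x (left_ne_zero_of_mul hx)
  exact h4.notMem_span_image hi (h3 h2)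

/-- Extend to a transcendence basis of ℂ[V]. The coordinates are algebraic over it, so generically
its differentials span everything; having dim V elements, they are independent. -/
theorem exists_linearIndependent_grad {J : Type*} (f : J → MvPolynomial κ ℂ)
    (hf : AlgebraicIndependent ℂ f) :
    ∃ q : MvPolynomial κ ℂ, q ≠ 0 ∧ ∀ x, eval x q ≠ 0 →
      LinearIndependent ℂ fun j => grad (f j) x := by
  classical
  obtain ⟨t, hst, ht⟩ := exists_isTranscendenceBasis_superset (R := ℂ) (s := Set.range f)
    hf.coe_range
  have hcard : Cardinal.mk t = Cardinal.mk κ := by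
    rw [ht.cardinalMk_eq_trdeg, MvPolynomial.trdeg_of_isDomain, Cardinal.lift_id']
  have hfin : Finite t := Cardinal.mk_lt_aleph0_iff.1 (hcard ▸ Cardinal.mk_lt_aleph0)
  have := Fintype.ofFinite t
  have halg := ht.isAlgebraic
  choose q hq hq' using fun k : κ => exists_grad_mem_span_of_isAlgebraic (halg.isAlgebraic (X k))
  refine ⟨∏ k, q k, Finset.prod_ne_zero_iff.2 fun k _ => hq k, fun x hx => ?_⟩
  rw [map_prod, Finset.prod_ne_zero_iff] at hx
  have hspan : ⊤ ≤ Submodule.span ℂ (Set.range fun g : t => grad (g : MvPolynomial κ ℂ) x) := by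
    rw [← (Pi.basisFun ℂ κ).span_eq, Submodule.span_le]
    rintro _ ⟨k, rfl⟩
    have h1 := hq' k x (hx k (Finset.mem_univ k))
    rw [grad_X] at h1
    rw [Pi.basisFun_apply]
    refine (Submodule.span_le.2 ?_) h1
    rintro _ ⟨g, hg, rfl⟩
    have h2 := grad_mem_span_of_mem_adjoin hg x
    rwa [← Set.range_comp] at h2
  have hli := linearIndependent_of_top_le_span_of_card_eq_finrank hspan (by
    rw [finrank_fintype_fun_eq_card]
    exact Fintype.card_eq.2 (Cardinal.eq.1 hcard))
  exact hli.comp (fun j => (⟨f j, hst ⟨j, rfl⟩⟩ : t))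
    fun i j h => hf.injective (congrArg Subtype.val h)

/-- At a generic point the differentials of a subalgebra span a space of dimension at least its
transcendence degree. -/
theorem exists_trdeg_le_finrank_grad (Y : Subalgebra ℂ (MvPolynomial κ ℂ)) :
    ∃ q : MvPolynomial κ ℂ, q ≠ 0 ∧ ∀ x, eval x q ≠ 0 → Algebra.trdeg ℂ Y ≤
      (finrank ℂ (Submodule.span ℂ ((fun g => grad g x) '' (Y : Set (MvPolynomial κ ℂ)))) :
        Cardinal) := by
  have hfaith : FaithfulSMul ℂ Y := (faithfulSMul_iff_algebraMap_injective ℂ Y).2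
    (algebraMap ℂ Y).injective
  obtain ⟨t, ht⟩ := exists_isTranscendenceBasis ℂ Y
  obtain ⟨q, hq, hq'⟩ := exists_linearIndependent_grad _
    (ht.1.map' (f := Y.val) Subtype.val_injective)
  refine ⟨q, hq, fun x hx => ?_⟩
  rw [← ht.cardinalMk_eq_trdeg]
  have h1 : LinearIndependent ℂ fun g : t => (⟨grad (g : Y) x, Submodule.subset_span
      ⟨_, (g : Y).2, rfl⟩⟩ : Submodule.span ℂ ((fun g => grad g x) ''
        (Y : Set (MvPolynomial κ ℂ)))) :=
    LinearIndependent.of_comp (Submodule.subtype _) (hq' x hx)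
  rw [finrank_eq_rank]
  exact h1.cardinal_le_rank

/-- At every point the differentials of a subalgebra span a space of dimension at most its
transcendence degree. -/
theorem finrank_grad_le_trdeg (Y : Subalgebra ℂ (MvPolynomial κ ℂ)) (x : κ → ℂ) :
    (finrank ℂ (Submodule.span ℂ ((fun g => grad g x) '' (Y : Set (MvPolynomial κ ℂ)))) :
      Cardinal) ≤ Algebra.trdeg ℂ Y := by
  obtain ⟨v, hv, -, hli⟩ := Submodule.exists_fun_fin_finrank_span_eq ℂ
    ((fun g => grad g x) '' (Y : Set (MvPolynomial κ ℂ)))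
  choose g hg hgv using hv
  have h1 : AlgebraicIndependent ℂ g := by
    refine algebraicIndependent_of_linearIndependent_grad g x ?_
    simp only [hgv]
    exact hli
  have h2 : AlgebraicIndependent ℂ fun i => (⟨g i, hg i⟩ : Y) := h1.of_comp Y.val
  have h3 := h2.lift_cardinalMk_le_trdeg
  simpa using h3

end Jacobian

/-! ### Polynomial curves -/

section Curves

/-- A functional vanishing on L turns the curve into a polynomial with infinitely many roots, so it
kills every coefficient. -/
theorem mem_of_forall_sum_pow_smul_mem {W : Type*} [AddCommGroup W] [Module ℂ W]
    (L : Submodule ℂ W) {n : ℕ} (w : Fin n → W) {Λ : Set ℂ} (hΛ : Λ.Infinite)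
    (h : ∀ c ∈ Λ, ∑ m : Fin n, c ^ (m : ℕ) • w m ∈ L) (m : Fin n) : w m ∈ L := by
  by_contra hm
  obtain ⟨θ, hθ, hL⟩ := Submodule.exists_le_ker_of_notMem hm
  let P : Polynomial ℂ := ∑ i : Fin n, Polynomial.monomial (i : ℕ) (θ (w i))
  have hP : P = 0 := by
    refine Polynomial.eq_zero_of_infinite_isRoot P (hΛ.mono fun c hc => ?_)
    have h1 : θ (∑ m : Fin n, c ^ (m : ℕ) • w m) = 0 := hL (h c hc)
    simp only [map_sum, map_smul, smul_eq_mul] at h1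
    simp only [P, Set.mem_ofPred_eq, Polynomial.IsRoot.def, Polynomial.eval_finsetSum,
      Polynomial.eval_monomial]
    simpa only [mul_comm] using h1
  have h2 := congrArg (fun Q => Polynomial.coeff Q (m : ℕ)) hP
  simp [P, Polynomial.finsetSum_coeff, Polynomial.coeff_monomial, Fin.val_inj] at h2
  exact hθ h2

theorem mem_of_forall_mem_infinite {W : Type*} [AddCommGroup W] [Module ℂ W]
    (L : Submodule ℂ W) (v : ℂ → W)
    (hv : ∀ θ : Dual ℂ W, ∃ P : Polynomial ℂ, ∀ c, θ (v c) = P.eval c) {Λ : Set ℂ}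
    (hΛ : Λ.Infinite) (h : ∀ c ∈ Λ, v c ∈ L) (c : ℂ) : v c ∈ L := by
  by_contra hc
  obtain ⟨θ, hθ, hL⟩ := Submodule.exists_le_ker_of_notMem hc
  obtain ⟨P, hP⟩ := hv θ
  have hP0 : P = 0 := by
    refine Polynomial.eq_zero_of_infinite_isRoot P (hΛ.mono fun c hc => ?_)
    rw [Set.mem_ofPred_eq, Polynomial.IsRoot.def, ← hP]
    exact hL (h c hc)
  exact hθ (by rw [hP, hP0, Polynomial.eval_zero])

variable {κ : Type*}

/-- The restriction of a polynomial to the line `t ↦ x + t a`. -/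
def line (x a : κ → ℂ) : MvPolynomial κ ℂ →ₐ[ℂ] Polynomial ℂ :=
  MvPolynomial.aeval fun k => Polynomial.C (x k) + Polynomial.C (a k) * Polynomial.X

theorem eval_line (x a : κ → ℂ) (f : MvPolynomial κ ℂ) (c : ℂ) :
    (line x a f).eval c = MvPolynomial.eval (x + c • a) f := by
  induction f using MvPolynomial.induction_on with
  | C r => simp [line]
  | add f g hf hg => simp [hf, hg]
  | mul_X f k hf =>
    rw [map_mul, Polynomial.eval_mul, hf, map_mul]
    simp [line, mul_comm c]

theorem infinite_setOf_eval_ne_zero {x a : κ → ℂ} {u : MvPolynomial κ ℂ}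
    (hu : MvPolynomial.eval x u ≠ 0) (F : Finset ℂ) :
    {c : ℂ | c ∉ F ∧ MvPolynomial.eval (x + c • a) u ≠ 0}.Infinite := by
  have hP : line x a u ≠ 0 := by
    intro h
    have h1 := eval_line x a u 0
    rw [h, Polynomial.eval_zero, zero_smul, add_zero] at h1
    exact hu h1.symm
  have hfin : (((F ∪ (line x a u).roots.toFinset : Finset ℂ) : Set ℂ)ᶜ).Infinite :=
    (Finset.finite_toSet _).infinite_compl
  refine hfin.mono fun c hc => ?_
  simp only [Finset.coe_union, Set.compl_union, Set.mem_inter_iff, Set.mem_compl_iff,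
    Finset.mem_coe, Multiset.mem_toFinset, Polynomial.mem_roots hP, Polynomial.IsRoot.def,
    eval_line] at hc
  exact hc

end Curves

/-! ### The rank of R_x and the differentials of shifted invariants -/

section Representation

variable {𝔤 V ι κ : Type*} [LieRing 𝔤] [LieAlgebra ℂ 𝔤] [AddCommGroup V] [Module ℂ V]
  [Fintype κ]

theorem R_add_smul (ρ : 𝔤 →ₗ⁅ℂ⁆ Module.End ℂ V) (x a : V) (c : ℂ) :
    R ρ (x + c • a) = R ρ x + c • R ρ a := by
  simp [R]

theorem finrank_range_le_dimOreg [FiniteDimensional ℂ V] (ρ : 𝔤 →ₗ⁅ℂ⁆ Module.End ℂ V) (x : V) :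
    finrank ℂ (LinearMap.range (R ρ x)) ≤ dimOreg ρ :=
  le_ciSup (f := fun x => finrank ℂ (LinearMap.range (R ρ x)))
    ⟨finrank ℂ V, by rintro _ ⟨x, rfl⟩; exact Submodule.finrank_le _⟩ x

theorem exists_finrank_range_eq_dimOreg [FiniteDimensional ℂ V] (ρ : 𝔤 →ₗ⁅ℂ⁆ Module.End ℂ V) :
    ∃ x, finrank ℂ (LinearMap.range (R ρ x)) = dimOreg ρ :=
  Nat.sSup_mem (Set.range_nonempty _)
    ⟨finrank ℂ V, by rintro _ ⟨x, rfl⟩; exact Submodule.finrank_le _⟩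

theorem dimOreg_le [FiniteDimensional ℂ V] (ρ : 𝔤 →ₗ⁅ℂ⁆ Module.End ℂ V) :
    dimOreg ρ ≤ finrank ℂ V := by
  obtain ⟨x, hx⟩ := exists_finrank_range_eq_dimOreg ρ
  rw [← hx]
  exact Submodule.finrank_le _

theorem finrank_ker_dualMap [FiniteDimensional ℂ V] {U : Type*} [AddCommGroup U] [Module ℂ U]
    (A : U →ₗ[ℂ] V) :
    finrank ℂ (LinearMap.ker A.dualMap) = finrank ℂ V - finrank ℂ (LinearMap.range A) := by
  have h1 := Subspace.finrank_add_finrank_dualAnnihilator_eq (LinearMap.range A)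
  rw [LinearMap.ker_dualMap_eq_dualAnnihilator_range]
  omega

/-- The coordinates of `R_x ξ` as polynomials in `x`. -/
def coordPoly (ρ : 𝔤 →ₗ⁅ℂ⁆ Module.End ℂ V) (bV : Basis κ ℂ V) (ξ : 𝔤) (k : κ) :
    MvPolynomial κ ℂ :=
  ∑ j, MvPolynomial.C (bV.equivFun (R ρ (bV j) ξ) k) * MvPolynomial.X j

theorem R_eq_sum (ρ : 𝔤 →ₗ⁅ℂ⁆ Module.End ℂ V) (bV : Basis κ ℂ V) (x : V) :
    R ρ x = ∑ j, bV.equivFun x j • R ρ (bV j) := by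
  conv_lhs => rw [← bV.sum_equivFun x]
  simp only [R, map_sum, map_smul]

theorem evalAt_coordPoly (ρ : 𝔤 →ₗ⁅ℂ⁆ Module.End ℂ V) (bV : Basis κ ℂ V) (ξ : 𝔤) (k : κ) (x : V) :
    MvPolynomial.eval (bV.equivFun x) (coordPoly ρ bV ξ k) = bV.equivFun (R ρ x ξ) k := by
  conv_rhs => rw [R_eq_sum ρ bV x, LinearMap.sum_apply, map_sum]
  simp only [coordPoly, map_sum, map_mul, MvPolynomial.eval_C, MvPolynomial.eval_X,
    LinearMap.smul_apply, map_smul, Finset.sum_apply, Pi.smul_apply, smul_eq_mul, mul_comm]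

theorem exists_finrank_range_eq (ρ : 𝔤 →ₗ⁅ℂ⁆ Module.End ℂ V) (bV : Basis κ ℂ V) :
    ∃ q : MvPolynomial κ ℂ, q ≠ 0 ∧ ∀ x, evalAt bV x q ≠ 0 →
      finrank ℂ (LinearMap.range (R ρ x)) = dimOreg ρ := by
  have := bV.finiteDimensional_of_finite
  obtain ⟨x₀, hx₀⟩ := exists_finrank_range_eq_dimOreg ρ
  obtain ⟨v, hv, -, hli⟩ := Submodule.exists_fun_fin_finrank_span_eq ℂ
    (LinearMap.range (R ρ x₀) : Set V)
  choose ξ hξ using hv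
  have he : ∀ x, (fun i k => MvPolynomial.eval (bV.equivFun x) (coordPoly ρ bV (ξ i) k))
      = fun i => bV.equivFun (R ρ x (ξ i)) := fun x =>
    funext fun i => funext fun k => evalAt_coordPoly ρ bV (ξ i) k x
  have hli' : LinearIndependent ℂ fun i k =>
      MvPolynomial.eval (bV.equivFun x₀) (coordPoly ρ bV (ξ i) k) := by
    rw [he]
    simp only [hξ]
    exact hli.map' bV.equivFun.toLinearMap (LinearEquiv.ker _)
  obtain ⟨q, hq, hq'⟩ := exists_eval_ne_zero_of_linearIndependent _ _ hli'
  refine ⟨q, fun h => hq (by rw [h, map_zero]), fun x hx => ?_⟩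
  refine le_antisymm (finrank_range_le_dimOreg ρ x) ?_
  have h1 := hq' _ hx
  rw [he] at h1
  have h2 : LinearIndependent ℂ fun i => R ρ x (ξ i) :=
    LinearIndependent.of_comp bV.equivFun.toLinearMap h1
  have h3 : LinearIndependent ℂ fun i => (⟨R ρ x (ξ i), ξ i, rfl⟩ : LinearMap.range (R ρ x)) :=
    LinearIndependent.of_comp (Submodule.subtype _) h2
  have h4 := h3.fintype_card_le_finrank
  rwa [Fintype.card_fin, Submodule.span_eq, hx₀] at h4

/-! ### The span of the differentials along a line -/

/-- The coordinate isomorphism of the dual space. -/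
def dualCoord (bV : Basis κ ℂ V) : (κ → ℂ) ≃ₗ[ℂ] Dual ℂ V :=
  bV.constr ℂ

theorem diffAt_eq_dualCoord (bV : Basis κ ℂ V) (f : MvPolynomial κ ℂ) (x : V) :
    diffAt bV f x = dualCoord bV (grad f (bV.equivFun x)) := by
  classical
  refine bV.ext fun k => ?_
  rw [dualCoord, Basis.constr_basis, diffAt, LinearMap.sum_apply]
  simp [grad, evalAt, Finsupp.single_apply]

/-- The span of the differentials of the invariants at the points of the line `x + t a`. -/
def diffSpan (ρ : 𝔤 →ₗ⁅ℂ⁆ Module.End ℂ V) (bV : Basis κ ℂ V) (x a : V) :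
    Submodule ℂ (Dual ℂ V) :=
  Submodule.span ℂ {φ | ∃ f ∈ invariants ρ bV, ∃ c : ℂ, φ = diffAt bV f (x + c • a)}

theorem pderiv_shift (bV : Basis κ ℂ V) (v : V) (f : MvPolynomial κ ℂ) (k : κ) :
    MvPolynomial.pderiv k (shift bV v f) = shift bV v (MvPolynomial.pderiv k f) := by
  classical
  simp only [shift]
  induction f using MvPolynomial.induction_on with
  | C r => simp
  | add f g hf hg => simp only [map_add, hf, hg]
  | mul_X f j hf =>
    simp only [map_mul, Derivation.leibniz, smul_eq_mul, map_add, hf, MvPolynomial.aeval_X,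
      MvPolynomial.pderiv_X, MvPolynomial.pderiv_C, add_zero]
    congr 2
    by_cases h : j = k
    · subst h; simp
    · simp [h]

theorem eval_shift (bV : Basis κ ℂ V) (v x : V) (f : MvPolynomial κ ℂ) :
    MvPolynomial.eval (bV.equivFun x) (shift bV v f)
      = MvPolynomial.eval (bV.equivFun (x + v)) f := by
  simp only [shift]
  induction f using MvPolynomial.induction_on with
  | C r => simp
  | add f g hf hg => simp only [map_add] at hf hg ⊢; rw [hf, hg]
  | mul_X f j hf => simp only [map_mul, hf]; simp

theorem grad_shift (bV : Basis κ ℂ V) (v x : V) (f : MvPolynomial κ ℂ) :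
    grad (shift bV v f) (bV.equivFun x) = grad f (bV.equivFun (x + v)) := by
  ext k
  rw [grad, pderiv_shift, eval_shift, grad]

/-- The differential at x of f shifted by ca is df(x + ca), and generators of an algebra already
span the differentials of the whole algebra. -/
theorem finrank_grad_Y (ρ : 𝔤 →ₗ⁅ℂ⁆ Module.End ℂ V) (bV : Basis κ ℂ V) (x a : V) :
    finrank ℂ (Submodule.span ℂ ((fun g => grad g (bV.equivFun x)) ''
      (Y ρ bV a : Set (MvPolynomial κ ℂ)))) = finrank ℂ (diffSpan ρ bV x a) := by
  have h1 : diffSpan ρ bV x a = (Submodule.span ℂ ((fun g => grad g (bV.equivFun x)) ''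
      (Y ρ bV a : Set (MvPolynomial κ ℂ)))).map (dualCoord bV : _ →ₗ[ℂ] Dual ℂ V) := by
    apply le_antisymm
    · rw [diffSpan, Submodule.span_le]
      rintro _ ⟨f, hf, c, rfl⟩
      refine ⟨grad (shift bV (c • a) f) (bV.equivFun x), Submodule.subset_span
        ⟨_, Algebra.subset_adjoin ⟨f, hf, c, rfl⟩, rfl⟩, ?_⟩
      rw [grad_shift, diffAt_eq_dualCoord]
      rfl
    · rw [Submodule.map_span, Submodule.span_le]
      rintro _ ⟨_, ⟨g, hg, rfl⟩, rfl⟩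
      have h2 := grad_mem_span_of_mem_adjoin hg (bV.equivFun x)
      have h3 := Submodule.mem_map_of_mem (f := (dualCoord bV : _ →ₗ[ℂ] Dual ℂ V)) h2
      refine (?_ : Submodule.map _ _ ≤ _) h3
      rw [Submodule.map_span, Submodule.span_le]
      rintro _ ⟨_, ⟨_, ⟨f, hf, c, rfl⟩, rfl⟩, rfl⟩
      refine Submodule.subset_span ⟨f, hf, c, ?_⟩
      rw [diffAt_eq_dualCoord, ← grad_shift]
      rfl
  rw [h1, LinearEquiv.finrank_map_eq]

end Representation

/-! ### Generic points -/

section PairPoly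

variable {κ : Type*}

/-- The polynomial on `V × V` obtained by evaluation at `x + c a`. -/
def pairPoly (c : ℂ) : MvPolynomial κ ℂ →ₐ[ℂ] MvPolynomial (κ ⊕ κ) ℂ :=
  MvPolynomial.aeval fun k => MvPolynomial.X (.inl k) + MvPolynomial.C c * MvPolynomial.X (.inr k)

theorem eval_pairPoly (x a : κ → ℂ) (c : ℂ) (f : MvPolynomial κ ℂ) :
    MvPolynomial.eval (Sum.elim x a) (pairPoly c f) = MvPolynomial.eval (x + c • a) f := by
  induction f using MvPolynomial.induction_on with
  | C r => simp [pairPoly]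
  | add f g hf hg => simp only [map_add, hf, hg]
  | mul_X f k hf =>
    rw [map_mul, map_mul, hf, map_mul]
    simp [pairPoly]

end PairPoly

section Generic

variable {𝔤 V ι κ : Type*} [LieRing 𝔤] [LieAlgebra ℂ 𝔤] [AddCommGroup V] [Module ℂ V]
  [Fintype κ]

/-- At a generic point the differentials of the invariants span the annihilator of the orbit. -/
theorem exists_span_diffAt_eq_ker (ρ : 𝔤 →ₗ⁅ℂ⁆ Module.End ℂ V) (bV : Basis κ ℂ V)
    (hρ : Algebra.trdeg ℂ (invariants ρ bV) = (codimOreg ρ : Cardinal)) :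
    ∃ u : MvPolynomial κ ℂ, u ≠ 0 ∧ ∀ x, evalAt bV x u ≠ 0 →
      finrank ℂ (LinearMap.range (R ρ x)) = dimOreg ρ ∧
      LinearMap.ker (R ρ x).dualMap =
        Submodule.span ℂ {φ | ∃ f ∈ invariants ρ bV, φ = diffAt bV f x} := by
  have := bV.finiteDimensional_of_finite
  obtain ⟨q₁, hq₁, h₁⟩ := exists_finrank_range_eq ρ bV
  obtain ⟨q₂, hq₂, h₂⟩ := exists_trdeg_le_finrank_grad (invariants ρ bV)
  refine ⟨q₁ * q₂, mul_ne_zero hq₁ hq₂, fun x hx => ?_⟩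
  rw [evalAt, map_mul] at hx
  have hr := h₁ x (left_ne_zero_of_mul hx)
  -- Invariance gives one inclusion. Equality is a dimension count: the kernel has dimension codim
  -- O_reg, which is the transcendence degree of the invariants by hypothesis, and so is at most the
  -- dimension of the span.
  refine ⟨hr, (Submodule.eq_of_le_of_finrank_le ?_ ?_).symm⟩
  · rw [Submodule.span_le]
    rintro _ ⟨f, hf, rfl⟩
    exact hf x
  · have h3 := h₂ _ (right_ne_zero_of_mul hx)
    rw [hρ, Nat.cast_le] at h3
    rw [finrank_ker_dualMap, hr]
    refine h3.trans ?_
    rw [← LinearEquiv.finrank_map_eq (dualCoord bV), Submodule.map_span]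
    refine Submodule.finrank_mono (Submodule.span_mono ?_)
    rintro _ ⟨_, ⟨f, hf, rfl⟩, rfl⟩
    exact ⟨f, hf, (diffAt_eq_dualCoord bV f x).symm⟩

theorem equivFun_add_smul (bV : Basis κ ℂ V) (x a : V) (c : ℂ) :
    bV.equivFun (x + c • a) = bV.equivFun x + c • bV.equivFun a := by
  rw [map_add, map_smul]

theorem exists_polynomial_diffAt (bV : Basis κ ℂ V) (f : MvPolynomial κ ℂ) (x a : V)
    (θ : Dual ℂ (Dual ℂ V)) :
    ∃ P : Polynomial ℂ, ∀ c, θ (diffAt bV f (x + c • a)) = P.eval c := by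
  refine ⟨∑ k, Polynomial.C (θ (bV.coord k)) *
    line (bV.equivFun x) (bV.equivFun a) (MvPolynomial.pderiv k f), fun c => ?_⟩
  simp only [diffAt, evalAt, map_sum, map_smul, smul_eq_mul, Polynomial.eval_finsetSum,
    Polynomial.eval_mul, Polynomial.eval_C, eval_line, equivFun_add_smul, mul_comm]

/-- At infinitely many c the kernel of (R_x + cR_a)^* is spanned both by the differentials at x + ca
and by the kernel curves; interpolation in c identifies the span of all differentials with the span
of all curve coefficients. Only x has to be generic, not a, which makes the equality case accessible
for a given a. -/
theorem pencilKVert_eq_finrank_diffSpan [FiniteDimensional ℂ 𝔤] (ρ : 𝔤 →ₗ⁅ℂ⁆ Module.End ℂ V)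
    (bV : Basis κ ℂ V) {u : MvPolynomial κ ℂ}
    (hu : ∀ x, evalAt bV x u ≠ 0 → LinearMap.ker (R ρ x).dualMap =
      Submodule.span ℂ {φ | ∃ f ∈ invariants ρ bV, φ = diffAt bV f x})
    {x : V} (hx : evalAt bV x u ≠ 0) (a : V) :
    pencilKVert (R ρ x) (R ρ a) = finrank ℂ (diffSpan ρ bV x a) := by
  have := bV.finiteDimensional_of_finite
  obtain ⟨J, _, d, w, F, -, hli, hk, hker, hspan⟩ :=
    exists_minimal_left_kernel_basis (R ρ x) (R ρ a)
  have hΛ := infinite_setOf_eval_ne_zero (a := bV.equivFun a) hx F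
  have hmem : ∀ c ∈ {c : ℂ | c ∉ F ∧ MvPolynomial.eval (bV.equivFun x + c • bV.equivFun a) u ≠ 0},
      LinearMap.ker (R ρ x + c • R ρ a).dualMap =
        Submodule.span ℂ {φ | ∃ f ∈ invariants ρ bV, φ = diffAt bV f (x + c • a)} := by
    rintro c ⟨-, hc⟩
    rw [← R_add_smul]
    exact hu _ (by rwa [evalAt, equivFun_add_smul])
  have heq : diffSpan ρ bV x a = Submodule.span ℂ (Set.range w) := by
    apply le_antisymm
    · rw [diffSpan, Submodule.span_le]
      rintro _ ⟨f, hf, c, rfl⟩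
      refine mem_of_forall_mem_infinite _ (fun c => diffAt bV f (x + c • a))
        (exists_polynomial_diffAt bV f x a) hΛ (fun c hc => ?_) c
      have h1 : diffAt bV f (x + c • a) ∈ LinearMap.ker (R ρ x + c • R ρ a).dualMap := by
        rw [hmem c hc]
        exact Submodule.subset_span ⟨f, hf, rfl⟩
      refine (Submodule.span_le.2 ?_) (hspan c hc.1 _ h1)
      rintro _ ⟨j, rfl⟩
      exact Submodule.sum_mem _ fun m _ => Submodule.smul_mem _ _
        (Submodule.subset_span ⟨_, rfl⟩)
    · rw [Submodule.span_le]
      rintro _ ⟨⟨j, m⟩, rfl⟩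
      refine mem_of_forall_sum_pow_smul_mem _ (fun m => w ⟨j, m⟩) hΛ (fun c hc => ?_) m
      have h1 : _ ∈ LinearMap.ker (R ρ x + c • R ρ a).dualMap := hker c j
      rw [hmem c hc] at h1
      refine Submodule.span_mono ?_ h1
      rintro _ ⟨f, hf, rfl⟩
      exact ⟨f, hf, c, rfl⟩
  rw [hk, heq, finrank_span_eq_card hli]
  simp

/-- The generic value of the total `v`-index is the maximal dimension of `diffSpan`. -/
theorem kVert_spec [FiniteDimensional ℂ 𝔤] (ρ : 𝔤 →ₗ⁅ℂ⁆ Module.End ℂ V)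
    (bV : Basis κ ℂ V) {u : MvPolynomial κ ℂ} (hu0 : u ≠ 0)
    (hu : ∀ x, evalAt bV x u ≠ 0 → LinearMap.ker (R ρ x).dualMap =
      Submodule.span ℂ {φ | ∃ f ∈ invariants ρ bV, φ = diffAt bV f x}) :
    (∀ x a, finrank ℂ (diffSpan ρ bV x a) ≤ kVert ρ bV) ∧
    ∀ q : MvPolynomial κ ℂ, q ≠ 0 → ∃ x a, evalAt bV x q ≠ 0 ∧
      pencilKVert (R ρ x) (R ρ a) = kVert ρ bV := by
  have := bV.finiteDimensional_of_finite
  let T : Set ℕ := Set.range fun z : V × V => finrank ℂ (diffSpan ρ bV z.1 z.2)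
  have hTb : BddAbove T := ⟨finrank ℂ (Dual ℂ V), by
    rintro _ ⟨z, rfl⟩; exact Submodule.finrank_le _⟩
  obtain ⟨⟨x₀, a₀⟩, hz⟩ := Nat.sSup_mem (Set.range_nonempty _) hTb
  have hmax : ∀ x a, finrank ℂ (diffSpan ρ bV x a) ≤ sSup T := fun x a =>
    le_csSup hTb ⟨(x, a), rfl⟩
  obtain ⟨v, hv, -, hli⟩ := Submodule.exists_fun_fin_finrank_span_eq ℂ
    {φ | ∃ f ∈ invariants ρ bV, ∃ c : ℂ, φ = diffAt bV f (x₀ + c • a₀)}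
  choose f hf c hfc using hv
  have he : ∀ x a, (fun i k => MvPolynomial.eval (Sum.elim (bV.equivFun x) (bV.equivFun a))
      (pairPoly (c i) (MvPolynomial.pderiv k (f i))))
      = fun i => (dualCoord bV).symm (diffAt bV (f i) (x + c i • a)) := by
    intro x a
    funext i
    rw [diffAt_eq_dualCoord, LinearEquiv.symm_apply_apply]
    funext k
    rw [eval_pairPoly, grad, equivFun_add_smul]
  have hli' : LinearIndependent ℂ fun i k =>
      MvPolynomial.eval (Sum.elim (bV.equivFun x₀) (bV.equivFun a₀))
        (pairPoly (c i) (MvPolynomial.pderiv k (f i))) := by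
    rw [he]
    simp only [← hfc]
    exact hli.map' (dualCoord bV).symm.toLinearMap (LinearEquiv.ker _)
  -- A basis of `diffSpan` at a point of maximal dimension, with its shift parameters frozen, stays
  -- independent on the open set q ≠ 0.
  obtain ⟨q, hq, hq'⟩ := exists_eval_ne_zero_of_linearIndependent _ _ hli'
  have hge : ∀ x a, MvPolynomial.eval (Sum.elim (bV.equivFun x) (bV.equivFun a)) q ≠ 0 →
      finrank ℂ (diffSpan ρ bV x a) = sSup T := by
    intro x a hxa
    refine le_antisymm (hmax x a) ?_
    have h1 := hq' _ hxa
    rw [he] at h1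
    have h2 : LinearIndependent ℂ fun i => diffAt bV (f i) (x + c i • a) :=
      LinearIndependent.of_comp (dualCoord bV).symm.toLinearMap h1
    have h3 : LinearIndependent ℂ fun i => (⟨diffAt bV (f i) (x + c i • a),
        Submodule.subset_span ⟨f i, hf i, c i, rfl⟩⟩ : diffSpan ρ bV x a) :=
      LinearIndependent.of_comp (Submodule.subtype _) h2
    have h4 := h3.fintype_card_le_finrank
    rw [Fintype.card_fin] at h4
    exact hz.symm.le.trans h4
  have hq0 : q ≠ 0 := fun h => hq (by rw [h, map_zero])
  -- points of `V × V` avoiding finitely many hypersurfaces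
  have hpt : ∀ Q : MvPolynomial (κ ⊕ κ) ℂ, Q ≠ 0 → ∃ x a : V,
      MvPolynomial.eval (Sum.elim (bV.equivFun x) (bV.equivFun a)) Q ≠ 0 := by
    intro Q hQ
    obtain ⟨y, hy⟩ := exists_eval_ne_zero hQ
    refine ⟨bV.equivFun.symm (y ∘ .inl), bV.equivFun.symm (y ∘ .inr), ?_⟩
    rwa [LinearEquiv.apply_symm_apply, LinearEquiv.apply_symm_apply, Sum.elim_comp_inl_inr]
  have hinl : ∀ p : MvPolynomial κ ℂ, p ≠ 0 → MvPolynomial.rename (Sum.inl : κ → κ ⊕ κ) p ≠ 0 :=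
    fun p hp h => hp (MvPolynomial.rename_injective _ Sum.inl_injective (by rw [h, map_zero]))
  have hinl' : ∀ (p : MvPolynomial κ ℂ) (x a : V),
      MvPolynomial.eval (Sum.elim (bV.equivFun x) (bV.equivFun a))
        (MvPolynomial.rename (Sum.inl : κ → κ ⊕ κ) p) = evalAt bV x p := by
    intro p x a
    rw [MvPolynomial.eval_rename, Sum.elim_comp_inl, evalAt]
  have hpencil : ∀ x a, MvPolynomial.eval (Sum.elim (bV.equivFun x) (bV.equivFun a))
      (q * MvPolynomial.rename Sum.inl u) ≠ 0 → pencilKVert (R ρ x) (R ρ a) = sSup T := by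
    intro x a h
    rw [map_mul, hinl'] at h
    rw [pencilKVert_eq_finrank_diffSpan ρ bV hu (right_ne_zero_of_mul h) a,
      hge x a (left_ne_zero_of_mul h)]
  have hk : kVert ρ bV = sSup T := by
    -- Non-empty open sets intersect, so only one generic value is possible.
    have hset : {k | ∃ S : Set (V × V), IsZariskiOpen bV S ∧ S.Nonempty ∧
        ∀ z ∈ S, pencilKVert (R ρ z.1) (R ρ z.2) = k} = {sSup T} := by
      ext k
      rw [Set.mem_singleton_iff]
      constructor
      · rintro ⟨S, ⟨P, rfl⟩, ⟨z, G, hG, hz⟩, hS⟩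
        obtain ⟨x, a, hxa⟩ := hpt (q * MvPolynomial.rename Sum.inl u * G)
          (mul_ne_zero (mul_ne_zero hq0 (hinl u hu0)) fun h => hz (by rw [h, map_zero]))
        rw [map_mul] at hxa
        rw [← hpencil x a (left_ne_zero_of_mul hxa)]
        exact (hS (x, a) ⟨G, hG, right_ne_zero_of_mul hxa⟩).symm
      · rintro rfl
        refine ⟨_, ⟨{q * MvPolynomial.rename Sum.inl u}, rfl⟩, ?_, ?_⟩
        · obtain ⟨x, a, hxa⟩ := hpt _ (mul_ne_zero hq0 (hinl u hu0))
          exact ⟨(x, a), _, rfl, hxa⟩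
        · rintro ⟨x, a⟩ ⟨_, rfl, h⟩
          exact hpencil x a h
    rw [kVert, hset, csInf_singleton]
  rw [hk]
  refine ⟨hmax, fun p hp => ?_⟩
  obtain ⟨x, a, hxa⟩ := hpt (q * MvPolynomial.rename Sum.inl u * MvPolynomial.rename Sum.inl p)
    (mul_ne_zero (mul_ne_zero hq0 (hinl u hu0)) (hinl p hp))
  rw [map_mul, hinl'] at hxa
  exact ⟨x, a, right_ne_zero_of_mul hxa, hpencil x a (left_ne_zero_of_mul hxa)⟩

end Generic

/-! ### Degrees of products and determinants -/

section Degrees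

open Polynomial

theorem natDegree_prod_le_and_coeff {R E : Type*} [CommRing R] (s : Finset E) (p : E → R[X])
    (n : E → ℕ) (h : ∀ i ∈ s, (p i).natDegree ≤ n i) :
    (∏ i ∈ s, p i).natDegree ≤ ∑ i ∈ s, n i ∧
      (∏ i ∈ s, p i).coeff (∑ i ∈ s, n i) = ∏ i ∈ s, (p i).coeff (n i) := by
  classical
  induction s using Finset.induction_on with
  | empty => simp
  | insert a s ha ih =>
    obtain ⟨h1, h2⟩ := ih fun i hi => h i (Finset.mem_insert_of_mem hi)
    have h3 := h a (Finset.mem_insert_self a s)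
    rw [Finset.prod_insert ha, Finset.sum_insert ha, Finset.prod_insert ha]
    exact ⟨natDegree_mul_le.trans (Nat.add_le_add h3 h1),
      by rw [coeff_mul_add_eq_of_natDegree_le h3 h1, h2]⟩

/-- When row i has degree at most n i, the top coefficient of the determinant is the determinant of
the row-wise top coefficients. Applied to the kernel curves, it detects their exact total degree. -/
theorem natDegree_det_le_and_coeff {R E : Type*} [CommRing R] [Fintype E] [DecidableEq E]
    (M : Matrix E E R[X]) (n : E → ℕ) (h : ∀ i j, (M i j).natDegree ≤ n i) :
    M.det.natDegree ≤ ∑ i, n i ∧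
      M.det.coeff (∑ i, n i) = (Matrix.of fun i j => (M i j).coeff (n i)).det := by
  have key : ∀ σ : Equiv.Perm E, (∏ i, M (σ i) i).natDegree ≤ ∑ i, n i ∧
      (∏ i, M (σ i) i).coeff (∑ i, n i) = ∏ i, (M (σ i) i).coeff (n (σ i)) := by
    intro σ
    have h1 := natDegree_prod_le_and_coeff Finset.univ (fun i => M (σ i) i) (fun i => n (σ i))
      fun i _ => h _ _
    rwa [Equiv.sum_comp σ n] at h1
  rw [Matrix.det_apply, Matrix.det_apply]
  constructor
  · refine natDegree_sum_le_of_forall_le _ _ fun σ _ => ?_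
    rw [Units.smul_def]
    exact (natDegree_smul_le _ _).trans (key σ).1
  · rw [finsetSum_coeff]
    refine Finset.sum_congr rfl fun σ _ => ?_
    rw [Units.smul_def, coeff_smul, (key σ).2, Units.smul_def]
    rfl

end Degrees

/-! ### Homogeneous polynomials -/

section Homogeneous

open MvPolynomial

variable {κ : Type*}

/-- The substitution `x ↦ t x`. -/
def dilate : MvPolynomial κ ℂ →ₐ[ℂ] Polynomial (MvPolynomial κ ℂ) :=
  aeval fun k => Polynomial.C (X k) * Polynomial.X

theorem dilate_monomial (m : κ →₀ ℕ) (r : ℂ) :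
    dilate (monomial m r) = Polynomial.monomial m.degree (monomial m r) := by
  rw [dilate, aeval_monomial]
  simp only [mul_pow, Finsupp.prod_mul]
  rw [← Polynomial.C_mul_X_pow_eq_monomial, monomial_eq, Polynomial.C_mul, mul_assoc]
  congr 2
  · simp only [Finsupp.prod, map_prod, map_pow]
  · rw [Finsupp.prod, Finset.prod_pow_eq_pow_sum]
    rfl

theorem coeff_dilate (f : MvPolynomial κ ℂ) (i : ℕ) :
    (dilate f).coeff i = homogeneousComponent i f := by
  induction f using MvPolynomial.induction_on' with
  | monomial m r =>
    rw [dilate_monomial, Polynomial.coeff_monomial,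
      homogeneousComponent_of_mem (isHomogeneous_monomial r rfl)]
    exact if_congr eq_comm rfl rfl
  | add f g hf hg => rw [map_add, Polynomial.coeff_add, hf, hg, map_add]

theorem isHomogeneous_of_coeff_dilate {f : MvPolynomial κ ℂ} {d : ℕ}
    (h : ∀ i, i ≠ d → (dilate f).coeff i = 0) : f.IsHomogeneous d := by
  intro m hm
  by_contra hne
  have h1 := h (Finsupp.weight 1 m) hne
  rw [coeff_dilate] at h1
  have h2 := congrArg (coeff m) h1
  rw [coeff_homogeneousComponent, if_pos (by rw [Finsupp.degree_eq_weight_one]; rfl)] at h2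
  exact hm h2

/-- A factor of a non-zero homogeneous polynomial is homogeneous. -/
theorem isHomogeneous_of_mul {f g : MvPolynomial κ ℂ} {d : ℕ} (h : (f * g).IsHomogeneous d)
    (hne : f * g ≠ 0) : ∃ i j, i + j = d ∧ f.IsHomogeneous i ∧ g.IsHomogeneous j := by
  have hinj : ∀ p : MvPolynomial κ ℂ, p ≠ 0 → dilate p ≠ 0 := by
    intro p hp h0
    refine hp ?_
    rw [← sum_homogeneousComponent p]
    refine Finset.sum_eq_zero fun i _ => ?_
    rw [← coeff_dilate, h0, Polynomial.coeff_zero]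
  have hf := hinj f (left_ne_zero_of_mul hne)
  have hg := hinj g (right_ne_zero_of_mul hne)
  -- The product is a single monomial in t. Degree and lowest degree are both additive, so they must
  -- agree for each factor.
  have hmul : dilate f * dilate g = Polynomial.monomial d (f * g) := by
    rw [← map_mul]
    ext1 i
    rw [coeff_dilate, Polynomial.coeff_monomial, homogeneousComponent_of_mem h]
    exact if_congr eq_comm rfl rfl
  have h1 := congrArg Polynomial.natDegree hmul
  have h2 := congrArg Polynomial.natTrailingDegree hmul
  rw [Polynomial.natDegree_mul hf hg, Polynomial.natDegree_monomial_eq _ hne] at h1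
  rw [Polynomial.natTrailingDegree_mul hf hg, Polynomial.natTrailingDegree_monomial hne] at h2
  have h3 := Polynomial.natTrailingDegree_le_natDegree (dilate f)
  have h4 := Polynomial.natTrailingDegree_le_natDegree (dilate g)
  have key : ∀ P : Polynomial (MvPolynomial κ ℂ), P.natTrailingDegree = P.natDegree →
      ∀ i, i ≠ P.natDegree → P.coeff i = 0 := by
    intro P hP i hi
    rcases lt_or_gt_of_ne hi with hlt | hgt
    · exact Polynomial.coeff_eq_zero_of_lt_natTrailingDegree (hP ▸ hlt)
    · exact Polynomial.coeff_eq_zero_of_natDegree_lt hgt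
  exact ⟨_, _, h1, isHomogeneous_of_coeff_dilate (key _ (by omega)),
    isHomogeneous_of_coeff_dilate (key _ (by omega))⟩

/-- The coefficient of t^d in f(x + ta) is f(a), so the degree along the line stays d exactly when
f(a) ≠ 0. -/
theorem natDegree_line_le_and_coeff {f : MvPolynomial κ ℂ} {d : ℕ} (hf : f.IsHomogeneous d)
    (x a : κ → ℂ) : (line x a f).natDegree ≤ d ∧ (line x a f).coeff d = eval a f := by
  have key : ∀ m ∈ f.support, (line x a (monomial m (f.coeff m))).natDegree ≤ d ∧
      (line x a (monomial m (f.coeff m))).coeff d = eval a (monomial m (f.coeff m)) := by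
    intro m hm
    have hd : ∑ k ∈ m.support, m k = d := by
      rw [← hf.degree_eq_sum_deg_support hm]
    have h1 := natDegree_prod_le_and_coeff m.support
      (fun k => (Polynomial.C (x k) + Polynomial.C (a k) * Polynomial.X) ^ m k) m fun k _ => by
        refine (Polynomial.natDegree_pow_le.trans (Nat.mul_le_mul_left _ ?_)).trans
          (mul_one (m k)).le
        rw [add_comm]
        exact Polynomial.natDegree_linear_le
    have h2 : ∀ k, ((Polynomial.C (x k) + Polynomial.C (a k) * Polynomial.X) ^ m k).coeff (m k)
        = a k ^ m k := by
      intro k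
      have h3 := Polynomial.coeff_pow_of_natDegree_le (p := Polynomial.C (x k) +
        Polynomial.C (a k) * Polynomial.X) (n := 1) (m := m k)
        (by rw [add_comm]; exact Polynomial.natDegree_linear_le)
      simpa using h3
    rw [hd] at h1
    have h4 : line x a (monomial m (f.coeff m)) = Polynomial.C (f.coeff m) *
        ∏ k ∈ m.support, (Polynomial.C (x k) + Polynomial.C (a k) * Polynomial.X) ^ m k := by
      rw [line, aeval_monomial]
      rfl
    rw [h4, eval_monomial]
    refine ⟨(Polynomial.natDegree_C_mul_le _ _).trans h1.1, ?_⟩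
    rw [Polynomial.coeff_C_mul, h1.2]
    simp only [h2]
    rfl
  rw [f.as_sum, map_sum, map_sum]
  constructor
  · exact Polynomial.natDegree_sum_le_of_forall_le _ _ fun m hm => (key m hm).1
  · rw [Polynomial.finsetSum_coeff]
    exact Finset.sum_congr rfl fun m hm => (key m hm).2

end Homogeneous

/-! ### Coprime families of polynomials -/

section Coprime

open Polynomial

attribute [local instance] Polynomial.algebra Polynomial.isLocalization

/-- A family of polynomials over a factorial ring without common factors generates an ideal that
contains a non-zero constant. -/
theorem exists_C_mem_span {S E : Type*} [CommRing S] [IsDomain S] [UniqueFactorizationMonoid S]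
    (F : E → S[X]) (h : ∀ p, (∀ e, p ∣ F e) → IsUnit p) :
    ∃ b : S, b ≠ 0 ∧ C b ∈ Ideal.span (Set.range F) := by
  classical
  obtain ⟨_⟩ : Nonempty (NormalizedGCDMonoid S) := inferInstance
  by_contra! hb
  let K := FractionRing S
  let J := Ideal.span (Set.range F)
  -- Without a non-zero constant the ideal stays proper over the fraction field K, where it is
  -- generated by a non-unit g dividing all F e.
  have hdis : Disjoint (((nonZeroDivisors S).map (C : S →+* S[X]) : Submonoid S[X]) : Set S[X])
      (J : Set S[X]) := by
    rw [Set.disjoint_left]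
    rintro _ ⟨b, hb0, rfl⟩ hmem
    exact hb b (nonZeroDivisors.ne_zero hb0) hmem
  have hne : J.map (algebraMap S[X] K[X]) ≠ ⊤ :=
    (IsLocalization.map_algebraMap_ne_top_iff_disjoint _ _ J).2 hdis
  obtain ⟨g, hg⟩ := (IsPrincipalIdealRing.principal (J.map (algebraMap S[X] K[X]))).principal
  have hgd : ∀ e, g ∣ (F e).map (algebraMap S K) := by
    intro e
    rw [← Ideal.mem_span_singleton]
    change algebraMap S[X] K[X] (F e) ∈ Submodule.span _ _
    rw [← hg]
    exact Ideal.mem_map_of_mem _ (Ideal.subset_span ⟨e, rfl⟩)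
  have hgu : ¬ IsUnit g := fun hu => hne (by
    rw [hg]
    exact Ideal.span_singleton_eq_top.2 hu)
  have hg0 : g ≠ 0 := by
    rintro rfl
    refine not_isUnit_zero (h 0 fun e => ?_)
    have h1 := zero_dvd_iff.1 (hgd e)
    rw [Polynomial.map_eq_zero_iff (IsFractionRing.injective S K)] at h1
    rw [h1]
  -- Clear denominators and pass to the primitive part; Gauss's lemma brings its divisibility of
  -- every F e back to S[X], against coprimality.
  let n := IsLocalization.integerNormalization (nonZeroDivisors S) g
  have hdvd : (n.primPart).map (algebraMap S K) ∣ g := by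
    obtain ⟨c, hc, h1⟩ := IsLocalization.integerNormalization_spec (nonZeroDivisors S) g
    have hc0 : algebraMap S K c ≠ 0 := by
      rw [Ne, IsFractionRing.to_map_eq_zero_iff]
      exact nonZeroDivisors.ne_zero hc
    have h2 : n.primPart.map (algebraMap S K) ∣ C (algebraMap S K c) * g := by
      refine ⟨C (algebraMap S K n.content), ?_⟩
      rw [← Polynomial.map_C (f := algebraMap S K) (a := n.content), ← Polynomial.map_mul,
        mul_comm n.primPart, ← n.eq_C_content_mul_primPart, h1, ← smul_eq_C_mul]
      exact (algebra_compatible_smul K c g).symm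
    exact (IsUnit.dvd_mul_left (isUnit_C.2 (isUnit_iff_ne_zero.2 hc0))).1 h2
  have hunit : IsUnit n.primPart := h _ fun e =>
    n.isPrimitive_primPart.dvd_of_fraction_map_dvd_fraction_map (hdvd.trans (hgd e))
  exact hgu (isUnit_or_eq_zero_of_isUnit_integerNormalization_primPart hg0 hunit)

end Coprime

/-! ### Coprime families restricted to lines -/

section Lines

open MvPolynomial

variable {κ E : Type*}

/-- The substitution `x ↦ x + t b`, `t ↦ t` in polynomials in `x` and `t`. -/
def translate (b : κ → ℂ) : Polynomial (MvPolynomial κ ℂ) →+* Polynomial (MvPolynomial κ ℂ) :=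
  Polynomial.eval₂RingHom (aeval (R := ℂ) (S₁ := Polynomial (MvPolynomial κ ℂ)) fun k =>
    Polynomial.C (X k) + Polynomial.C (C (b k)) * Polynomial.X).toRingHom Polynomial.X

theorem translate_X (b : κ → ℂ) : translate b Polynomial.X = Polynomial.X :=
  Polynomial.eval₂_X _ _

theorem translate_C_X (b : κ → ℂ) (k : κ) : translate b (Polynomial.C (X k)) =
    Polynomial.C (X k) + Polynomial.C (C (b k)) * Polynomial.X := by
  simp [translate]

theorem translate_C_C (b : κ → ℂ) (r : ℂ) :
    translate b (Polynomial.C (C r)) = Polynomial.C (C r) := by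
  simp [translate]

theorem translate_translate {b b' : κ → ℂ} (h : b + b' = 0) (f : Polynomial (MvPolynomial κ ℂ)) :
    translate b (translate b' f) = f := by
  have h1 : (translate b).comp (translate b') = RingHom.id _ := by
    refine Polynomial.ringHom_ext' (MvPolynomial.ringHom_ext (fun r => ?_) fun k => ?_) ?_
    · simp [translate_C_C]
    · have h2 : b' k = - b k := by
        have := congrFun h k
        simp only [Pi.add_apply, Pi.zero_apply] at this
        linear_combination this
      simp only [RingHom.comp_apply, map_add, map_mul, translate_C_C, translate_C_X, translate_X,
        h2, map_neg, RingHom.id_apply]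
      ring
    · simp [translate_X]
  exact congrArg (fun φ => φ f) h1

theorem map_eval_translate (a x : κ → ℂ) (f : MvPolynomial κ ℂ) :
    (translate a (Polynomial.C f)).map (eval x) = line x a f := by
  induction f using MvPolynomial.induction_on with
  | C r => simp [translate_C_C, line]
  | add f g hf hg => simp only [map_add, Polynomial.map_add, hf, hg]
  | mul_X f k hf =>
    simp only [map_mul, Polynomial.map_mul, hf, translate_C_X]
    simp [line]

/-- Polynomials without common factors have no common zeros on a generic line of a given
direction. -/
theorem exists_forall_exists_eval_line_ne_zero (α : E → MvPolynomial κ ℂ)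
    (h : ∀ p, (∀ e, p ∣ α e) → IsUnit p) (a : κ → ℂ) :
    ∃ q : MvPolynomial κ ℂ, q ≠ 0 ∧ ∀ x, eval x q ≠ 0 → ∀ c, ∃ e, (line x a (α e)).eval c ≠ 0 := by
  -- The substitution x ↦ x + ta is an automorphism over ℂ[t], so it creates no common factors; a
  -- common divisor of polynomials in x alone is itself free of t.
  have hunit : ∀ p, (∀ e, p ∣ translate a (Polynomial.C (α e))) → IsUnit p := by
    intro p hp
    have h1 : ∀ e, translate (-a) p ∣ Polynomial.C (α e) := by
      intro e
      have h2 := map_dvd (translate (-a)) (hp e)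
      rwa [translate_translate (neg_add_cancel a)] at h2
    have h3 : ∃ β, translate (-a) p = Polynomial.C β := by
      by_cases h0 : ∀ e, α e = 0
      · exact absurd (h 0 fun e => by rw [h0 e]) not_isUnit_zero
      · push Not at h0
        obtain ⟨e, he⟩ := h0
        have h4 := Polynomial.natDegree_le_of_dvd (h1 e) (by simpa using he)
        rw [Polynomial.natDegree_C, Nat.le_zero] at h4
        exact ⟨_, Polynomial.eq_C_of_natDegree_eq_zero h4⟩
    obtain ⟨β, hβ⟩ := h3
    have h5 : IsUnit β := by
      refine h β fun e => ?_
      have h6 := h1 e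
      rw [hβ, Polynomial.C_dvd_iff_dvd_coeff] at h6
      simpa using h6 0
    have h7 : p = translate a (Polynomial.C β) := by
      rw [← hβ, translate_translate (add_neg_cancel a)]
    rw [h7]
    exact (h5.map Polynomial.C).map (translate a)
  -- Some b(x) ≠ 0 is a combination of the α_e(x + ta) over ℂ[V][t], so a common root t on the line
  -- through x forces b(x) = 0.
  obtain ⟨b, hb0, hb⟩ := exists_C_mem_span _ hunit
  refine ⟨b, hb0, fun x hx c => ?_⟩
  by_contra! hc
  have h1 : Ideal.span (Set.range fun e => translate a (Polynomial.C (α e))) ≤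
      RingHom.ker ((Polynomial.evalRingHom c).comp (Polynomial.mapRingHom (eval x))) := by
    rw [Ideal.span_le]
    rintro _ ⟨e, rfl⟩
    change Polynomial.eval c (Polynomial.map (eval x) (translate a (Polynomial.C (α e)))) = 0
    rw [map_eval_translate, hc]
  have h2 : Polynomial.eval c (Polynomial.map (eval x) (Polynomial.C b)) = 0 := h1 hb
  rw [Polynomial.map_C, Polynomial.eval_C] at h2
  exact hx h2

/-- A family of polynomials proportional to a family without common roots is a multiple of it. -/
theorem exists_eq_mul_of_cross_mul [Fintype E] {f g : E → Polynomial ℂ}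
    (hfg : ∀ e e', f e * g e' = f e' * g e) (hf : ∀ c, ∃ e, (f e).eval c ≠ 0) :
    ∃ q, ∀ e, g e = q * f e := by
  obtain ⟨p, hp⟩ := (IsPrincipalIdealRing.principal (Ideal.span (Set.range f))).principal
  have hdvd : ∀ e, p ∣ f e := by
    intro e
    rw [← Ideal.mem_span_singleton]
    change _ ∈ Submodule.span _ _
    rw [← hp]
    exact Ideal.subset_span ⟨e, rfl⟩
  have hroot : ∀ c, p.eval c ≠ 0 := by
    intro c hc
    obtain ⟨e, he⟩ := hf c
    exact he (Polynomial.eval_eq_zero_of_dvd_of_eval_eq_zero (hdvd e) hc)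
  have hunit : IsUnit p := by
    rw [Polynomial.isUnit_iff_degree_eq_zero]
    by_contra hd
    obtain ⟨c, hc⟩ := IsAlgClosed.exists_root p hd
    exact hroot c hc
  have h1 : (1 : Polynomial ℂ) ∈ Ideal.span (Set.range f) := by
    rw [hp]
    exact Ideal.mem_span_singleton.2 hunit.dvd
  obtain ⟨c, hc⟩ := Ideal.mem_span_range_iff_exists_fun.1 h1
  -- The family f has a Bézout relation Σ c_e f_e = 1; the same combination of the g_e is the
  -- multiplier.
  refine ⟨∑ e, c e * g e, fun e' => ?_⟩
  calc g e' = (∑ e, c e * f e) * g e' := by rw [hc, one_mul]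
    _ = _ := by
      rw [Finset.sum_mul, Finset.sum_mul]
      refine Finset.sum_congr rfl fun e _ => ?_
      rw [mul_assoc, hfg e e']
      ring

end Lines

/-! ### Complementary minors -/

section Minors

open Matrix

variable {κ : Type*} [Fintype κ]

theorem exists_embedding_det_ne_zero {s : ℕ} (v : Matrix (Fin s) κ ℂ)
    (hv : LinearIndependent ℂ v.row) :
    ∃ w : Fin s ↪ κ, (v.submatrix id w).det ≠ 0 := by
  have hrank : finrank ℂ (Submodule.span ℂ (Set.range v.col)) = s := by
    rw [← Matrix.rank_eq_finrank_span_cols, hv.rank_matrix, Fintype.card_fin]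
  obtain ⟨u, hu, -, hli⟩ := Submodule.exists_fun_fin_finrank_span_eq ℂ (Set.range v.col)
  choose w hw using hu
  let w' : Fin s → κ := fun i => w (Fin.cast hrank.symm i)
  have hli' : LinearIndependent ℂ (v.submatrix id w').col := by
    have h1 := hli.comp (Fin.cast hrank.symm) (Fin.cast_injective _)
    have h2 : (v.submatrix id w').col = u ∘ Fin.cast hrank.symm := funext fun i => hw _
    rwa [h2]
  refine ⟨⟨w', fun i j hij => hli'.injective ?_⟩, ?_⟩
  · funext k
    simp only [Matrix.col_apply, Matrix.submatrix_apply, hij]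
  · rw [Matrix.linearIndependent_cols_iff_isUnit, Matrix.isUnit_iff_isUnit_det] at hli'
    exact hli'.ne_zero

theorem exists_equiv_extending {A B C : Type*} [Fintype A] [Fintype B] [Fintype C]
    (h : Fintype.card A + Fintype.card B = Fintype.card C) (f : A ↪ C) :
    ∃ e : A ⊕ B ≃ C, ∀ i, e (.inl i) = f i := by
  classical
  have hc : Fintype.card B = Fintype.card ((Set.range f)ᶜ : Set C) := by
    rw [Fintype.card_compl_set, Set.card_range_of_injective f.injective]
    omega
  refine ⟨(Equiv.sumCongr f.toEquivRange (Fintype.equivOfCardEq hc)).trans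
    (Equiv.Set.sumCompl (Set.range f)), fun i => ?_⟩
  simp

/-- Complementary minors of orthogonal matrices are proportional. -/
theorem exists_sign_mul_det_eq [DecidableEq κ] {r s : ℕ} (v : Matrix (Fin s) κ ℂ) (hv : LinearIndependent ℂ v.row)
    (M : Matrix κ (Fin r) ℂ) (hvM : v * M = 0) (e₀ : Fin r ⊕ Fin s ≃ κ) :
    ∃ c : ℂ, ∀ e : Fin r ⊕ Fin s ≃ κ,
      ((Equiv.Perm.sign (e.trans e₀.symm) : ℤ) : ℂ) * (M.submatrix (e ∘ Sum.inl) id).det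
        = c * (v.submatrix id (e ∘ Sum.inr)).det := by
  obtain ⟨w, hw⟩ := exists_embedding_det_ne_zero v hv
  have hcard : Fintype.card (Fin s) + Fintype.card (Fin r) = Fintype.card κ := by
    rw [← Fintype.card_congr e₀, Fintype.card_sum, add_comm]
  obtain ⟨e', he'⟩ := exists_equiv_extending hcard w
  let e₁ : Fin r ⊕ Fin s ≃ κ := (Equiv.sumComm _ _).trans e'
  have he₁ : (e₁ ∘ Sum.inr : Fin s → κ) = w := funext he'
  -- Coordinate rows complementary to a non-zero maximal minor of v complete v to an invertible
  -- square matrix W.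
  let P : Matrix (Fin r) κ ℂ := Matrix.of fun i k => if e₁ (.inl i) = k then 1 else 0
  let W : Matrix (Fin r ⊕ Fin s) κ ℂ := Matrix.fromRows P v
  have hW : ∀ e : Fin r ⊕ Fin s ≃ κ, (W.submatrix id e).det
      = ((Equiv.Perm.sign (e.trans e₀.symm) : ℤ) : ℂ) * (W.submatrix id e₀).det := by
    intro e
    rw [← Matrix.det_permute', Matrix.submatrix_submatrix]
    congr 2
    funext i
    simp
  have hblocks : ∀ e : Fin r ⊕ Fin s ≃ κ, W.submatrix id e =
      Matrix.fromBlocks (P.submatrix id (e ∘ Sum.inl)) (P.submatrix id (e ∘ Sum.inr))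
        (v.submatrix id (e ∘ Sum.inl)) (v.submatrix id (e ∘ Sum.inr)) := by
    intro e
    ext (i | i) (j | j) <;> rfl
  have hW₀ : (W.submatrix id e₀).det ≠ 0 := by
    intro h0
    have h1 := hW e₁
    rw [h0, mul_zero, hblocks] at h1
    have h2 : P.submatrix id (e₁ ∘ Sum.inl) = 1 := by
      ext i j
      simp [P, Matrix.one_apply]
    have h3 : P.submatrix id (e₁ ∘ Sum.inr) = 0 := by
      ext i j
      simp [P]
    rw [h2, h3, Matrix.det_fromBlocks_zero₁₂, Matrix.det_one, one_mul, he₁] at h1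
    exact hw h1
  have hsplit : ∀ (e : Fin r ⊕ Fin s ≃ κ) {l : ℕ} (Q : Matrix (Fin l) κ ℂ),
      Q.submatrix id (e ∘ Sum.inl) * M.submatrix (e ∘ Sum.inl) id +
        Q.submatrix id (e ∘ Sum.inr) * M.submatrix (e ∘ Sum.inr) id = Q * M := by
    intro e l Q
    ext i j
    simp only [Matrix.add_apply, Matrix.mul_apply, Matrix.submatrix_apply, id_eq,
      Function.comp_apply]
    rw [← Equiv.sum_comp e, Fintype.sum_sum_type]
  refine ⟨(P * M).det / (W.submatrix id e₀).det, fun e => ?_⟩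
  -- Since vM = 0, this product is block triangular. Its determinant relates the minor of M to the
  -- complementary minor of v, and det W depends on e only through the sign.
  have h1 : W.submatrix id e * Matrix.fromBlocks (M.submatrix (e ∘ Sum.inl) id) 0
      (M.submatrix (e ∘ Sum.inr) id) 1 = Matrix.fromBlocks (P * M)
        (P.submatrix id (e ∘ Sum.inr)) 0 (v.submatrix id (e ∘ Sum.inr)) := by
    rw [hblocks, Matrix.fromBlocks_multiply, hsplit, hsplit, hvM]
    simp
  have h2 := congrArg Matrix.det h1
  rw [Matrix.det_mul, Matrix.det_fromBlocks_zero₁₂, Matrix.det_one, mul_one,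
    Matrix.det_fromBlocks_zero₂₁, hW] at h2
  field_simp
  linear_combination h2

end Minors

/-! ### Minors of a pencil and its left minimal indices -/

section PencilMinors

theorem linearIndependent_sum_smul {J W : Type*} [Fintype J] [AddCommGroup W] [Module ℂ W]
    {d : J → ℕ} {w : (Σ j, Fin (d j)) → W} (hw : LinearIndependent ℂ w)
    (b : (Σ j, Fin (d j)) → ℂ) (hb : ∀ j, ∃ m, b ⟨j, m⟩ ≠ 0) :
    LinearIndependent ℂ fun j => ∑ m, b ⟨j, m⟩ • w ⟨j, m⟩ := by
  rw [Fintype.linearIndependent_iff] at hw ⊢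
  intro g hg j
  obtain ⟨m, hm⟩ := hb j
  have h1 := hw (fun p => g p.1 * b p) (by
    rw [Fintype.sum_sigma, ← hg]
    simp only [Finset.smul_sum, smul_smul]) ⟨j, m⟩
  exact (mul_eq_zero.1 h1).resolve_right hm

variable {U V κ : Type*} [AddCommGroup U] [Module ℂ U] [AddCommGroup V] [Module ℂ V]
theorem linearIndependent_row_dual (bV : Basis κ ℂ V) {s : ℕ} {φ : Fin s → Dual ℂ V}
    (h : LinearIndependent ℂ φ) :
    LinearIndependent ℂ (Matrix.of fun i k => φ i (bV k)).row := by
  have h1 := h.map' (dualCoord bV).symm.toLinearMap (LinearEquiv.ker _)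
  have h2 : (Matrix.of fun i k => φ i (bV k)).row = (dualCoord bV).symm.toLinearMap ∘ φ := by
    funext i
    refine (dualCoord bV).injective (bV.ext fun k => ?_)
    rw [dualCoord, Basis.constr_basis]
    simp [Matrix.row]
  rwa [h2]

theorem exists_equiv_det_ne_zero [Fintype κ] {r s : ℕ} (e₀ : Fin r ⊕ Fin s ≃ κ) (v : Matrix (Fin s) κ ℂ)
    (hv : LinearIndependent ℂ v.row) :
    ∃ e : Fin r ⊕ Fin s ≃ κ, (v.submatrix id (e ∘ Sum.inr)).det ≠ 0 := by
  obtain ⟨w, hw⟩ := exists_embedding_det_ne_zero v hv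
  have hcard : Fintype.card (Fin s) + Fintype.card (Fin r) = Fintype.card κ := by
    rw [← Fintype.card_congr e₀, Fintype.card_sum, add_comm]
  obtain ⟨e, he⟩ := exists_equiv_extending hcard w
  refine ⟨(Equiv.sumComm _ _).trans e, ?_⟩
  have h1 : ((Equiv.sumComm _ _).trans e ∘ Sum.inr : Fin s → κ) = w := funext he
  rwa [h1]

/-- Suppose that `A + c B` has rank at most `r` for all `c`, and that the maximal minors of the
columns `t` of the pencil are `γ α_e`.  Then, up to a common factor, the `α_e` are the maximal
minors of a minimal basis of the left kernel of the pencil. -/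
theorem exists_minors_of_left_kernel [Fintype κ] [DecidableEq κ] [FiniteDimensional ℂ U]
    (A B : U →ₗ[ℂ] V) (bV : Basis κ ℂ V)
    {r s : ℕ} (e₀ : Fin r ⊕ Fin s ≃ κ) (t : Fin r → U) (γ : Polynomial ℂ)
    (α : (Fin r ⊕ Fin s ≃ κ) → Polynomial ℂ)
    (hrank : ∀ c : ℂ, finrank ℂ (LinearMap.range (A + c • B)) ≤ r)
    (hminor : ∀ (c : ℂ) (e : Fin r ⊕ Fin s ≃ κ), ((Equiv.Perm.sign (e.trans e₀.symm) : ℤ) : ℂ) *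
      ((Matrix.of fun k j => bV.equivFun ((A + c • B) (t j)) k).submatrix (e ∘ Sum.inl) id).det
        = γ.eval c * (α e).eval c)
    {e₁ : Fin r ⊕ Fin s ≃ κ} (he₁ : γ * α e₁ ≠ 0) :
    ∃ (D : ℕ) (δ : (Fin r ⊕ Fin s ≃ κ) → Polynomial ℂ) (q : Polynomial ℂ),
      pencilKVert A B = s + D ∧ (∀ e, (δ e).natDegree ≤ D) ∧ (∃ e, (δ e).coeff D ≠ 0) ∧
      ∀ e, α e = q * δ e := by
  have := bV.finiteDimensional_of_finite
  obtain ⟨J, _, d, w, F, hd, hli, hk, hker, hspan⟩ := exists_minimal_left_kernel_basis A B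
  let ψ : ℂ → J → Dual ℂ V := fun c j => ∑ m : Fin (d j), c ^ (m : ℕ) • w ⟨j, m⟩
  -- The constant coefficient of each curve enters with factor c^0 = 1, so independence holds at
  -- every c, without exception.
  have hψ : ∀ c, LinearIndependent ℂ (ψ c) := fun c =>
    linearIndependent_sum_smul hli (fun p => c ^ (p.2 : ℕ)) fun j => ⟨⟨0, hd j⟩, by simp⟩
  -- At a c outside F with γ α_{e₁} ≠ 0 the rank is exactly r, so the kernel has dimension s and the
  -- ψ c form a basis of it.
  have hcard : Fintype.card J = s := by
    obtain ⟨c, hc⟩ : ∃ c, c ∉ F ∧ (γ * α e₁).eval c ≠ 0 := by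
      have hfin : (((F ∪ (γ * α e₁).roots.toFinset : Finset ℂ) : Set ℂ)ᶜ).Infinite :=
        (Finset.finite_toSet _).infinite_compl
      obtain ⟨c, hc⟩ := hfin.nonempty
      refine ⟨c, ?_⟩
      simpa only [Finset.coe_union, Set.compl_union, Set.mem_inter_iff, Set.mem_compl_iff,
        Finset.mem_coe, Multiset.mem_toFinset, Polynomial.mem_roots he₁,
        Polynomial.IsRoot.def] using hc
    have hdet : ((Matrix.of fun k j => bV.equivFun ((A + c • B) (t j)) k).submatrix
        (e₁ ∘ Sum.inl) id).det ≠ 0 := by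
      intro h0
      have h1 := hminor c e₁
      rw [h0, mul_zero, ← Polynomial.eval_mul] at h1
      exact hc.2 h1.symm
    have hcols : LinearIndependent ℂ fun j => (A + c • B) (t j) := by
      have h1 : LinearIndependent ℂ ((Matrix.of fun k j =>
          bV.equivFun ((A + c • B) (t j)) k).submatrix (e₁ ∘ Sum.inl) id).col := by
        rw [Matrix.linearIndependent_cols_iff_isUnit, Matrix.isUnit_iff_isUnit_det]
        exact isUnit_iff_ne_zero.2 hdet
      exact LinearIndependent.of_comp
        (LinearMap.funLeft ℂ ℂ (e₁ ∘ Sum.inl) ∘ₗ bV.equivFun.toLinearMap) h1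
    have hr : finrank ℂ (LinearMap.range (A + c • B)) = r := by
      refine le_antisymm (hrank c) ?_
      have h1 : LinearIndependent ℂ fun j =>
          (⟨(A + c • B) (t j), t j, rfl⟩ : LinearMap.range (A + c • B)) :=
        LinearIndependent.of_comp (Submodule.subtype _) hcols
      simpa using h1.fintype_card_le_finrank
    have heq : LinearMap.ker (A + c • B).dualMap = Submodule.span ℂ (Set.range (ψ c)) := by
      apply le_antisymm
      · exact fun φ hφ => hspan c hc.1 φ hφ
      · rw [Submodule.span_le]
        rintro _ ⟨j, rfl⟩
        exact hker c j
    have h1 := finrank_ker_dualMap (A + c • B)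
    rw [heq, finrank_span_eq_card (hψ c), hr, finrank_eq_card_basis bV,
      ← Fintype.card_congr e₀, Fintype.card_sum, Fintype.card_fin, Fintype.card_fin] at h1
    omega
  let j : Fin s ≃ J := (Fintype.equivFinOfCardEq hcard).symm
  let v : Matrix (Fin s) κ (Polynomial ℂ) := Matrix.of fun i k =>
    ∑ m : Fin (d (j i)), Polynomial.monomial (m : ℕ) (w ⟨j i, m⟩ (bV k))
  let δ : (Fin r ⊕ Fin s ≃ κ) → Polynomial ℂ := fun e => (v.submatrix id (e ∘ Sum.inr)).det
  let vc : ℂ → Matrix (Fin s) κ ℂ := fun c => Matrix.of fun i k => ψ c (j i) (bV k)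
  have hv : ∀ c i k, (v i k).eval c = vc c i k := by
    intro c i k
    simp only [v, vc, ψ, Matrix.of_apply, Polynomial.eval_finsetSum, Polynomial.eval_monomial,
      LinearMap.sum_apply, LinearMap.smul_apply, smul_eq_mul, mul_comm]
  have hδ : ∀ c e, (δ e).eval c = ((vc c).submatrix id (e ∘ Sum.inr)).det := by
    intro c e
    rw [← Polynomial.coe_evalRingHom, RingHom.map_det]
    congr 1
    ext i k
    exact hv c i _
  have hrow : ∀ c, LinearIndependent ℂ (vc c).row := fun c =>
    linearIndependent_row_dual bV ((hψ c).comp j j.injective)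
  -- At each c the signed minors of A + cB in the columns t and the complementary minors of the
  -- kernel curves are proportional; γ is then cancelled.
  have hcross : ∀ e e', δ e * α e' = δ e' * α e := by
    intro e e'
    refine mul_left_cancel₀ (left_ne_zero_of_mul he₁) (Polynomial.funext fun c => ?_)
    obtain ⟨z, hz⟩ := exists_sign_mul_det_eq (vc c) (hrow c)
      (Matrix.of fun k i => bV.equivFun ((A + c • B) (t i)) k) (by
        ext i l
        rw [Matrix.mul_apply, Matrix.zero_apply]
        have h1 : ψ c (j i) ((A + c • B) (t l)) = 0 := congrArg (fun φ => φ (t l)) (hker c (j i))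
        conv_rhs => rw [← h1, ← bV.sum_equivFun ((A + c • B) (t l)), map_sum]
        refine Finset.sum_congr rfl fun k _ => ?_
        rw [map_smul, smul_eq_mul, mul_comm]
        rfl) e₀
    have h1 := hz e
    have h2 := hz e'
    rw [hminor, ← hδ] at h1 h2
    simp only [Polynomial.eval_mul]
    linear_combination (δ e).eval c * h2 - (δ e').eval c * h1
  have hroot : ∀ c, ∃ e, (δ e).eval c ≠ 0 := by
    intro c
    obtain ⟨e, he⟩ := exists_equiv_det_ne_zero e₀ (vc c) (hrow c)
    exact ⟨e, by rwa [hδ]⟩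
  obtain ⟨q, hq⟩ := exists_eq_mul_of_cross_mul hcross hroot
  have hdeg : ∀ e, (δ e).natDegree ≤ ∑ i, (d (j i) - 1) ∧ (δ e).coeff (∑ i, (d (j i) - 1)) =
      (Matrix.of fun i k => (v i ((e ∘ Sum.inr) k)).coeff (d (j i) - 1)).det := by
    intro e
    refine natDegree_det_le_and_coeff _ (fun i => d (j i) - 1) fun i k => ?_
    simp only [v, Matrix.submatrix_apply, Matrix.of_apply, id_eq]
    refine Polynomial.natDegree_sum_le_of_forall_le _ _ fun m _ => ?_
    exact (Polynomial.natDegree_monomial_le _).trans (Nat.le_sub_one_of_lt m.isLt)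
  refine ⟨∑ i, (d (j i) - 1), δ, q, ?_, fun e => (hdeg e).1, ?_, hq⟩
  · rw [hk, ← Equiv.sum_comp j d]
    calc ∑ i, d (j i) = ∑ i, (1 + (d (j i) - 1)) :=
          Finset.sum_congr rfl fun i _ => by have := hd (j i); omega
      _ = _ := by simp [Finset.sum_add_distrib]
  -- The leading coefficients of the curves are distinct members of the independent family w, so one
  -- of their maximal minors is non-zero and the degree D is reached.
  · let top : Fin s → Σ j, Fin (d j) := fun i => ⟨j i, ⟨d (j i) - 1, by have := hd (j i); omega⟩⟩
    have htop : LinearIndependent ℂ (w ∘ top) :=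
      hli.comp top fun i i' h => j.injective (congrArg Sigma.fst h)
    obtain ⟨e, he⟩ := exists_equiv_det_ne_zero e₀ _ (linearIndependent_row_dual bV htop)
    refine ⟨e, ?_⟩
    rw [(hdeg e).2]
    convert he using 2
    ext i k
    have h1 : ∀ m : Fin (d (j i)), (m : ℕ) = d (j i) - 1 ↔ m = (top i).2 :=
      fun m => by rw [Fin.ext_iff]
    simp only [v, Matrix.of_apply, Polynomial.finsetSum_coeff, Polynomial.coeff_monomial, h1,
      Finset.sum_ite_eq', Finset.mem_univ, if_true]
    rfl

end PencilMinors

/-! ### The minors of `R_x` -/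

section GCD

variable {S E : Type*} [CommMonoidWithZero S] [UniqueFactorizationMonoid S] [Fintype E]

theorem exists_greatest_common_divisor (f : E → S) :
    ∃ p, (∀ e, p ∣ f e) ∧ ∀ q, (∀ e, q ∣ f e) → q ∣ p := by
  obtain ⟨_⟩ : Nonempty (NormalizedGCDMonoid S) := inferInstance
  exact ⟨Finset.univ.gcd f, fun e => Finset.gcd_dvd (Finset.mem_univ e),
    fun q hq => Finset.dvd_gcd fun e _ => hq e⟩

/-- Coprimality is stated with a multiplier h: h = 1 excludes common factors, and general h allows
α_e' to be divided out of a family h α_e. -/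
theorem exists_eq_mul_coprime [Nonempty E] (f : E → S) :
    ∃ (g : S) (α : E → S), (∀ e, f e = g * α e) ∧ ∀ b h, (∀ e, b ∣ h * α e) → b ∣ h := by
  obtain ⟨_⟩ : Nonempty (NormalizedGCDMonoid S) := inferInstance
  obtain ⟨α, hα, hgcd⟩ := Finset.extract_gcd (s := Finset.univ) f Finset.univ_nonempty
  refine ⟨_, α, fun e => hα e (Finset.mem_univ _), fun b h hb => ?_⟩
  have h1 : b ∣ Finset.univ.gcd fun e => h * α e := Finset.dvd_gcd fun e _ => hb e
  have h2 := h1.trans (Finset.gcd_mul_left' Finset.univ α h).dvd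
  rwa [hgcd, mul_one] at h2

end GCD

/-! ### Minors of matrices of bounded rank -/

section MatrixRank

variable {ι κ : Type*} [Fintype ι] [Fintype κ]

theorem exists_det_submatrix_ne_zero {r : ℕ} (M : Matrix κ ι ℂ) (hM : M.rank = r) :
    ∃ (S : Fin r ↪ κ) (T : Fin r ↪ ι), (M.submatrix S T).det ≠ 0 := by
  obtain ⟨u, hu, hli⟩ : ∃ u : Fin r → κ → ℂ, (∀ i, u i ∈ Set.range M.col) ∧
      LinearIndependent ℂ u := by
    obtain ⟨u, hu, -, hli⟩ := Submodule.exists_fun_fin_finrank_span_eq ℂ (Set.range M.col)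
    have hr : r = finrank ℂ (Submodule.span ℂ (Set.range M.col)) := by
      rw [← Matrix.rank_eq_finrank_span_cols, hM]
    exact ⟨u ∘ Fin.cast hr, fun i => hu _, hli.comp _ (Fin.cast_injective hr)⟩
  choose T hT using hu
  obtain rfl : (fun i => M.col (T i)) = u := funext hT
  obtain ⟨S, hS⟩ := exists_embedding_det_ne_zero (M.submatrix id T).transpose hli
  refine ⟨S, ⟨T, fun i j hij => hli.injective (congrArg M.col hij)⟩, ?_⟩
  rwa [← Matrix.det_transpose]

/-- If the columns T are independent, the columns T' are combinations of them, so passing from T to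
T' multiplies every minor by the same determinant. If they are dependent, both sides vanish. -/
theorem det_submatrix_mul_det_submatrix {r : ℕ} (M : Matrix κ ι ℂ) (hM : M.rank ≤ r)
    (S S' : Fin r → κ) (T T' : Fin r → ι) :
    (M.submatrix S T).det * (M.submatrix S' T').det
      = (M.submatrix S T').det * (M.submatrix S' T).det := by
  by_cases h : LinearIndependent ℂ fun i => M.col (T i)
  · have hle : Submodule.span ℂ (Set.range fun i => M.col (T i)) ≤
        Submodule.span ℂ (Set.range M.col) :=
      Submodule.span_mono (by rintro _ ⟨i, rfl⟩; exact ⟨T i, rfl⟩)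
    have heq := Submodule.eq_of_le_of_finrank_le hle (by
      rw [← Matrix.rank_eq_finrank_span_cols, finrank_span_eq_card h, Fintype.card_fin]
      exact hM)
    have hmem : ∀ j, ∃ c : Fin r → ℂ, ∑ i, c i • M.col (T i) = M.col (T' j) := by
      intro j
      rw [← Submodule.mem_span_range_iff_exists_fun, heq]
      exact Submodule.subset_span ⟨T' j, rfl⟩
    choose c hc using hmem
    have hmul : ∀ Q : Fin r → κ, M.submatrix Q T' =
        M.submatrix Q T * Matrix.of fun i j => c j i := by
      intro Q
      ext l j
      have h1 := congrFun (hc j) (Q l)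
      simp only [Finset.sum_apply, Pi.smul_apply, smul_eq_mul, Matrix.col_apply] at h1
      simp only [Matrix.mul_apply, Matrix.submatrix_apply, Matrix.of_apply, ← h1, mul_comm]
    rw [hmul S', hmul S, Matrix.det_mul, Matrix.det_mul]
    ring
  · have h0 : ∀ Q : Fin r → κ, (M.submatrix Q T).det = 0 := by
      intro Q
      by_contra hne
      have h1 : LinearIndependent ℂ (M.submatrix Q T).col := by
        rw [Matrix.linearIndependent_cols_iff_isUnit, Matrix.isUnit_iff_isUnit_det]
        exact isUnit_iff_ne_zero.2 hne
      exact h (LinearIndependent.of_comp (LinearMap.funLeft ℂ ℂ Q) h1)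
    rw [h0, h0, zero_mul, mul_zero]

end MatrixRank

/-! ### The bound s + d for the generic v-index -/

section Representation

variable {𝔤 V ι κ : Type*} [LieRing 𝔤] [LieAlgebra ℂ 𝔤] [AddCommGroup V] [Module ℂ V]
  [Fintype ι] [DecidableEq ι] [Fintype κ]
  (ρ : 𝔤 →ₗ⁅ℂ⁆ Module.End ℂ V) (b𝔤 : Basis ι ℂ 𝔤) (bV : Basis κ ℂ V)

theorem evalAt_genMatrix (x : V) (k : κ) (i : ι) :
    evalAt bV x (genMatrix ρ b𝔤 bV k i) = LinearMap.toMatrix b𝔤 bV (R ρ x) k i := by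
  conv_rhs => rw [R_eq_sum ρ bV x, map_sum, Matrix.sum_apply]
  simp only [evalAt, genMatrix, Matrix.of_apply, map_sum, map_mul, MvPolynomial.eval_C,
    MvPolynomial.eval_X, map_smul, Matrix.smul_apply, smul_eq_mul, mul_comm]

theorem evalAt_minor (x : V) (S : Fin (dimOreg ρ) ↪ κ) (T : Fin (dimOreg ρ) ↪ ι) :
    evalAt bV x (minor ρ b𝔤 bV S T)
      = ((LinearMap.toMatrix b𝔤 bV (R ρ x)).submatrix S T).det := by
  rw [evalAt, minor, RingHom.map_det]
  congr 1
  ext i j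
  exact evalAt_genMatrix ρ b𝔤 bV x _ _

theorem rank_toMatrix_R (x : V) :
    (LinearMap.toMatrix b𝔤 bV (R ρ x)).rank = finrank ℂ (LinearMap.range (R ρ x)) := by
  rw [Matrix.rank_eq_finrank_range_toLin _ bV b𝔤, Matrix.toLin_toMatrix]

theorem exists_minor_ne_zero : ∃ S T, minor ρ b𝔤 bV S T ≠ 0 := by
  have := bV.finiteDimensional_of_finite
  obtain ⟨x, hx⟩ := exists_finrank_range_eq_dimOreg ρ
  obtain ⟨S, T, h⟩ := exists_det_submatrix_ne_zero (LinearMap.toMatrix b𝔤 bV (R ρ x))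
    ((rank_toMatrix_R ρ b𝔤 bV x).trans hx)
  refine ⟨S, T, fun h0 => h ?_⟩
  rw [← evalAt_minor, h0, evalAt, map_zero]

theorem minor_mul_minor (S S' : Fin (dimOreg ρ) ↪ κ) (T T' : Fin (dimOreg ρ) ↪ ι) :
    minor ρ b𝔤 bV S T * minor ρ b𝔤 bV S' T' = minor ρ b𝔤 bV S T' * minor ρ b𝔤 bV S' T := by
  have := bV.finiteDimensional_of_finite
  refine MvPolynomial.funext fun y => ?_
  have h1 := det_submatrix_mul_det_submatrix
    (LinearMap.toMatrix b𝔤 bV (R ρ (bV.equivFun.symm y)))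
    ((rank_toMatrix_R ρ b𝔤 bV _).le.trans (finrank_range_le_dimOreg ρ _)) S S' T T'
  simp only [← evalAt_minor, evalAt, LinearEquiv.apply_symm_apply] at h1
  rw [map_mul, map_mul, h1]

theorem isHomogeneous_minor (S : Fin (dimOreg ρ) ↪ κ) (T : Fin (dimOreg ρ) ↪ ι) :
    (minor ρ b𝔤 bV S T).IsHomogeneous (dimOreg ρ) := by
  have hentry : ∀ k i, (genMatrix ρ b𝔤 bV k i).IsHomogeneous 1 := fun k i =>
    MvPolynomial.IsHomogeneous.sum _ _ _ fun j _ => by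
      simpa using (MvPolynomial.isHomogeneous_C κ _).mul (MvPolynomial.isHomogeneous_X ℂ j)
  rw [minor, Matrix.det_apply']
  refine MvPolynomial.IsHomogeneous.sum _ _ _ fun σ _ => ?_
  have h1 := MvPolynomial.IsHomogeneous.prod Finset.univ
    (fun i => (genMatrix ρ b𝔤 bV).submatrix S T (σ i) i) (fun _ => 1) fun i _ => hentry _ _
  have h2 := (MvPolynomial.isHomogeneous_C κ ((Equiv.Perm.sign σ : ℤ) : ℂ)).mul h1
  simpa using h2

theorem exists_isFundamentalSemiInvariant [DecidableEq κ] : ∃ p, IsFundamentalSemiInvariant ρ b𝔤 bV p := by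
  obtain ⟨p, hp, hq⟩ := exists_greatest_common_divisor
    fun z : (Fin (dimOreg ρ) ↪ κ) × (Fin (dimOreg ρ) ↪ ι) => minor ρ b𝔤 bV z.1 z.2
  exact ⟨p, fun S T => hp (S, T), fun q h => hq q fun z => h z.1 z.2⟩

/-- The total `v`-index of the pencils `R_x + t R_a` for generic `x` is bounded by a constant that
is attained when `a ∉ Sing₁`. -/
theorem exists_pencilKVert_bound [DecidableEq κ] :
    ∃ (q₀ : MvPolynomial κ ℂ) (K : ℕ), q₀ ≠ 0 ∧
      (∀ x a, evalAt bV x q₀ ≠ 0 → pencilKVert (R ρ x) (R ρ a) ≤ K) ∧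
      ∀ a ∉ Sing₁ ρ b𝔤 bV, ∃ q₁ : MvPolynomial κ ℂ, q₁ ≠ 0 ∧ ∀ x, evalAt bV x q₀ ≠ 0 →
        evalAt bV x q₁ ≠ 0 → K ≤ pencilKVert (R ρ x) (R ρ a) := by
  have := bV.finiteDimensional_of_finite
  have := b𝔤.finiteDimensional_of_finite
  obtain ⟨S₀, T, hST⟩ := exists_minor_ne_zero ρ b𝔤 bV
  obtain ⟨s, hs⟩ : ∃ s, dimOreg ρ + s = Fintype.card κ := by
    rw [← finrank_eq_card_basis bV]
    exact Nat.exists_eq_add_of_le (dimOreg_le ρ) |>.imp fun s h => h.symm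
  have hext : ∀ S : Fin (dimOreg ρ) ↪ κ, ∃ e : Fin (dimOreg ρ) ⊕ Fin s ≃ κ,
      Function.Embedding.inl.trans e.toEmbedding = S := by
    intro S
    obtain ⟨e, he⟩ := exists_equiv_extending (B := Fin s) (by simpa using hs) S
    exact ⟨e, Function.Embedding.ext he⟩
  obtain ⟨e₀, he₀⟩ := hext S₀
  let sgn : (Fin (dimOreg ρ) ⊕ Fin s ≃ κ) → ℂ := fun e =>
    ((Equiv.Perm.sign (e.trans e₀.symm) : ℤ) : ℂ)
  have hsgn : ∀ e, sgn e * sgn e = 1 := by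
    intro e
    rcases Int.units_eq_one_or (Equiv.Perm.sign (e.trans e₀.symm)) with h | h <;> simp [sgn, h]
  let rows : (Fin (dimOreg ρ) ⊕ Fin s ≃ κ) → (Fin (dimOreg ρ) ↪ κ) := fun e =>
    Function.Embedding.inl.trans e.toEmbedding
  let mm : (Fin (dimOreg ρ) ⊕ Fin s ≃ κ) → MvPolynomial κ ℂ := fun e =>
    MvPolynomial.C (sgn e) * minor ρ b𝔤 bV (rows e) T
  have : Nonempty (Fin (dimOreg ρ) ⊕ Fin s ≃ κ) := ⟨e₀⟩
  obtain ⟨g, α, hα, hgcd⟩ := exists_eq_mul_coprime mm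
  have hmm₀ : mm e₀ ≠ 0 := by
    refine mul_ne_zero ?_ (by rw [show rows e₀ = S₀ from he₀]; exact hST)
    rw [Ne, MvPolynomial.C_eq_zero]
    exact left_ne_zero_of_mul_eq_one (hsgn e₀)
  have hhom : ∀ e, (mm e).IsHomogeneous (dimOreg ρ) := fun e => by
    simpa using (MvPolynomial.isHomogeneous_C κ (sgn e)).mul
      (isHomogeneous_minor ρ b𝔤 bV (rows e) T)
  have hg0 : g ≠ 0 := left_ne_zero_of_mul (hα e₀ ▸ hmm₀)
  -- All minors have degree r, so g and each non-zero α e are homogeneous, and the degree d = r −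
  -- deg g does not depend on e.
  obtain ⟨i₀, d, hid, hgi, hαd⟩ := isHomogeneous_of_mul (hα e₀ ▸ hhom e₀) (hα e₀ ▸ hmm₀)
  have hαhom : ∀ e, (α e).IsHomogeneous d := by
    intro e
    by_cases h0 : α e = 0
    · rw [h0]
      exact MvPolynomial.isHomogeneous_zero _ _ _
    · obtain ⟨i, j, hij, hi, hj⟩ := isHomogeneous_of_mul (hα e ▸ hhom e) (mul_ne_zero hg0 h0)
      have h1 := hi.inj_right hgi hg0
      obtain rfl : j = d := by omega
      exact hj
  have hcop : ∀ p, (∀ e, p ∣ α e) → IsUnit p := fun p hp =>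
    isUnit_of_dvd_one (hgcd p 1 fun e => (hp e).mul_left 1)
  have hpencil : ∀ x a, evalAt bV x (mm e₀) ≠ 0 →
      ∃ (D : ℕ) (δ : (Fin (dimOreg ρ) ⊕ Fin s ≃ κ) → Polynomial ℂ) (q : Polynomial ℂ),
      pencilKVert (R ρ x) (R ρ a) = s + D ∧ (∀ e, (δ e).natDegree ≤ D) ∧
      (∃ e, (δ e).coeff D ≠ 0) ∧
      (∀ e, line (bV.equivFun x) (bV.equivFun a) (α e) = q * δ e) ∧ q ≠ 0 := by
    intro x a hx
    have hne : line (bV.equivFun x) (bV.equivFun a) g *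
        line (bV.equivFun x) (bV.equivFun a) (α e₀) ≠ 0 := by
      intro h0
      rw [← map_mul, ← hα] at h0
      have h1 := eval_line (bV.equivFun x) (bV.equivFun a) (mm e₀) 0
      rw [h0, Polynomial.eval_zero, zero_smul, add_zero] at h1
      exact hx h1.symm
    obtain ⟨D, δ, q, h1, h2, h3, h4⟩ := exists_minors_of_left_kernel (R ρ x) (R ρ a) bV e₀
      (b𝔤 ∘ T) (line (bV.equivFun x) (bV.equivFun a) g)
      (fun e => line (bV.equivFun x) (bV.equivFun a) (α e))
      (fun c => by rw [← R_add_smul]; exact finrank_range_le_dimOreg ρ _)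
      (fun c e => by
        rw [← Polynomial.eval_mul, ← map_mul, ← hα, eval_line, ← equivFun_add_smul, map_mul,
          MvPolynomial.eval_C]
        have h5 := evalAt_minor ρ b𝔤 bV (x + c • a) (rows e) T
        rw [evalAt] at h5
        rw [h5, ← R_add_smul]
        congr 2
        ext i j
        simp [rows, LinearMap.toMatrix_apply]) hne
    refine ⟨D, δ, q, h1, h2, h3, h4, ?_⟩
    rintro rfl
    rw [h4 e₀, zero_mul, mul_zero] at hne
    exact hne rfl
  refine ⟨mm e₀, s + d, hmm₀, fun x a hx => ?_, fun a ha => ?_⟩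
  -- Take e with deg δ e = D: then D ≤ deg (q δ e) ≤ d.
  · obtain ⟨D, δ, q, hk, -, ⟨e, he⟩, hq, hq0⟩ := hpencil x a hx
    have h1 := (natDegree_line_le_and_coeff (hαhom e) (bV.equivFun x) (bV.equivFun a)).1
    have hδ0 : δ e ≠ 0 := by
      rintro h0
      rw [h0, Polynomial.coeff_zero] at he
      exact he rfl
    rw [hq e, Polynomial.natDegree_mul hq0 hδ0] at h1
    have h2 := Polynomial.le_natDegree_of_ne_zero he
    omega
  · obtain ⟨e', he'⟩ : ∃ e, evalAt bV a (α e) ≠ 0 := by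
      obtain ⟨p, hp⟩ := exists_isFundamentalSemiInvariant ρ b𝔤 bV
      have h1 : ¬ ∀ S T h, minor ρ b𝔤 bV S T = p * h → evalAt bV a h = 0 :=
        fun h => ha ⟨p, hp, h⟩
      push Not at h1
      obtain ⟨S', T', h, hph, hha⟩ := h1
      obtain ⟨e', he'⟩ := hext S'
      have hp0 : p ≠ 0 := by
        rintro rfl
        exact hST (zero_dvd_iff.1 (hp.1 S₀ T))
      -- The ratio of two row sets is the same in the columns T and T', so after cancelling g and p,
      -- h α_e is a multiple of α_e'. By coprimality α_e' divides h, and h(a) ≠ 0 gives α_e'(a) ≠ 0.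
      have hdvd : ∀ e, α e' ∣ h * α e := by
        intro e
        obtain ⟨k, hk⟩ := hp.1 (rows e) T'
        have h2 := minor_mul_minor ρ b𝔤 bV (rows e) (rows e') T T'
        rw [show rows e' = S' from he', hph, hk] at h2
        have h3 := hα e
        have h4 := hα e'
        simp only [mm] at h3 h4
        rw [show rows e' = S' from he'] at h4
        have h5 : MvPolynomial.C (sgn e') * MvPolynomial.C (sgn e') = (1 : MvPolynomial κ ℂ) := by
          rw [← map_mul, hsgn, map_one]
        refine ⟨k * MvPolynomial.C (sgn e) * MvPolynomial.C (sgn e'),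
          mul_left_cancel₀ (mul_ne_zero hg0 hp0) ?_⟩
        linear_combination (-p * h) * h3 + MvPolynomial.C (sgn e) * h2 +
          (p * k * MvPolynomial.C (sgn e) * MvPolynomial.C (sgn e')) * h4 -
          (p * k * MvPolynomial.C (sgn e) * minor ρ b𝔤 bV S' T) * h5
      obtain ⟨k, rfl⟩ := hgcd _ h hdvd
      rw [evalAt, map_mul] at hha
      exact ⟨e', left_ne_zero_of_mul hha⟩
    obtain ⟨q₁, hq₁, hline⟩ := exists_forall_exists_eval_line_ne_zero α hcop (bV.equivFun a)
    refine ⟨q₁, hq₁, fun x hx hx₁ => ?_⟩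
    obtain ⟨D, δ, q, hk, hδ, -, hq, hq0⟩ := hpencil x a hx
    -- A root of q would be a common zero of the α_e on a line that avoids all of them.
    have hdeg : q.natDegree = 0 := by
      by_contra hne
      obtain ⟨c, hc⟩ := IsAlgClosed.exists_root q fun h =>
        hne (Polynomial.natDegree_eq_of_degree_eq_some h)
      obtain ⟨e, he⟩ := hline _ hx₁ c
      rw [hq e, Polynomial.eval_mul, Polynomial.IsRoot.def.1 hc, zero_mul] at he
      exact he rfl
    have h1 := (natDegree_line_le_and_coeff (hαhom e') (bV.equivFun x) (bV.equivFun a)).2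
    have h2 : d ≤ (q * δ e').natDegree := by
      rw [← hq e']
      exact Polynomial.le_natDegree_of_ne_zero (h1 ▸ he')
    have h3 : (q * δ e').natDegree ≤ q.natDegree + (δ e').natDegree := Polynomial.natDegree_mul_le
    have h4 := hδ e'
    omega

end Representation

end JK
end

/-! ### The inequality and the equality case -/

theorem mainTheorem1 {𝔤 V ι κ : Type*} [LieRing 𝔤] [LieAlgebra ℂ 𝔤]
    [AddCommGroup V] [Module ℂ V]
    [Fintype ι] [DecidableEq ι] [Fintype κ] [DecidableEq κ]
    (b𝔤 : Module.Basis ι ℂ 𝔤) (bV : Module.Basis κ ℂ V)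
    (ρ : 𝔤 →ₗ⁅ℂ⁆ Module.End ℂ V)
    (hρ : Algebra.trdeg ℂ (JK.invariants ρ bV) = (JK.codimOreg ρ : Cardinal)) (a : V) :
    Algebra.trdeg ℂ (JK.Y ρ bV a) ≤ (JK.kVert ρ bV : Cardinal) ∧
    (a ∉ JK.Sing₁ ρ b𝔤 bV →
      Algebra.trdeg ℂ (JK.Y ρ bV a) = (JK.kVert ρ bV : Cardinal)) := by
  have := b𝔤.finiteDimensional_of_finite
  obtain ⟨u, hu0, hu⟩ := JK.exists_span_diffAt_eq_ker ρ bV hρ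
  obtain ⟨hmax, hgen⟩ := JK.kVert_spec ρ bV hu0 fun x hx => (hu x hx).2
  have hpt : ∀ q : MvPolynomial κ ℂ, q ≠ 0 → ∃ x : V, JK.evalAt bV x q ≠ 0 := by
    intro q hq
    obtain ⟨y, hy⟩ := JK.exists_eval_ne_zero hq
    exact ⟨bV.equivFun.symm y, by rwa [JK.evalAt, LinearEquiv.apply_symm_apply]⟩
  have hle : Algebra.trdeg ℂ (JK.Y ρ bV a) ≤ (JK.kVert ρ bV : Cardinal) := by
    obtain ⟨q, hq0, hq⟩ := JK.exists_trdeg_le_finrank_grad (JK.Y ρ bV a)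
    obtain ⟨x, hx⟩ := hpt q hq0
    refine (hq _ hx).trans ?_
    rw [JK.finrank_grad_Y, Nat.cast_le]
    exact hmax x a
  refine ⟨hle, fun ha => le_antisymm hle ?_⟩
  obtain ⟨q₀, K, hq₀, hupper, hlower⟩ := JK.exists_pencilKVert_bound ρ b𝔤 bV
  obtain ⟨q₁, hq₁, hK⟩ := hlower a ha
  have hkK : JK.kVert ρ bV ≤ K := by
    obtain ⟨x, a', hx, hk⟩ := hgen q₀ hq₀
    exact hk ▸ hupper x a' hx
  -- At such x the v-index of R_x + λR_a is at least K ≥ `kVert`, and it equals the dimension of the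
  -- differentials of Y_a at x, which never exceeds trdeg Y_a.
  obtain ⟨x, hx⟩ := hpt (u * q₀ * q₁) (mul_ne_zero (mul_ne_zero hu0 hq₀) hq₁)
  rw [JK.evalAt, map_mul, map_mul] at hx
  have hxu := left_ne_zero_of_mul (left_ne_zero_of_mul hx)
  have hx0 := right_ne_zero_of_mul (left_ne_zero_of_mul hx)
  have h1 := hkK.trans (hK x hx0 (right_ne_zero_of_mul hx))
  rw [JK.pencilKVert_eq_finrank_diffSpan ρ bV (fun x hx => (hu x hx).2) hxu a,
    ← JK.finrank_grad_Y] at h1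
  exact (Nat.cast_le.2 h1).trans (JK.finrank_grad_le_trdeg (JK.Y ρ bV a) (bV.equivFun x))
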